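/- Conventions. Let $G$ be a compact matrix quantum group, given by the Hopf $*$-algebra $\mathcal A$ (coproduct $\phi$, counit $\epsilon$) of polynomial functions on $G$: $\phi$ is a $*$-homomorphism, and $\mathcal A$ is generated as an algebra by the entries of one unitary matrix $U$ over $\mathcal A$ with $\phi(U_{ij})=\sum_k U_{ik}\otimes U_{kj}$. The objects of $R(G)$ are the unitary representations $u\colon H_u\to H_u\otimes\mathcal A$ of $G$ in finite-dimensional unitary spaces. The arrows are $\mathrm M(u,v)=\mathrm{Mor}(u,v)\oplus\overline{\mathrm M}(u,v)$: in degree $0$ the linear $f\colon H_u\to H_v$ with $vf=(f\otimes\mathrm{id})u$, in degree $1$ the antilinear $f$ with $vf=(f\otimes *)u$. The product $u\times v$ acts in $H_u\otimes H_v$. Degree $0$ arrows $\varphi\in\mathrm{Mor}(u,v)$, $\psi\in\mathrm{Mor}(p,q)$ have the product $\varphi\otimes\psi\colon u\times p\to v\times q$, and degree $1$ arrows $\varphi\in\overline{\mathrm M}(u,q)$, $\psi\in\overline{\mathrm M}(p,v)$ have the product $[\varphi,\psi]\colon u\times p\to v\times q$, $x\otimes y\mapsto\psi(y)\otimes\varphi(x)$.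 Let $\mathcal V$ be a unital complex $*$-algebra, representing the quantum space $M$, and let $\otimes_M$ be the tensor product over $\mathcal V$. $\Phi_M$ is the category of $\mathcal V$-bimodules that are finitely generated and projective both as left and as right modules. Its arrows are $\mathrm H(\mathcal J,\mathcal K)=\mathrm{Hom}(\mathcal J,\mathcal K)\oplus\overline{\mathrm H}(\mathcal J,\mathcal K)$: in degree $0$ the bimodule homomorphisms, in degree $1$ the antilinear $T$ with $T(aj)=T(j)a^*$, $T(ja)=a^*T(j)$. The twisted product of degree $1$ arrows $S\colon\mathcal J\to\mathcal K'$, $T\colon\mathcal K\to\mathcal J'$ is $[S,T]\colon\mathcal J\otimes_M\mathcal K\to\mathcal J'\otimes_M\mathcal K'$, $j\otimes k\mapsto T(k)\otimes S(j)$. A quantum principal $G$-bundle $P=(\mathcal B,i,F)$ over $M$ consists of a unital $*$-algebra $\mathcal B$ and unital $*$-homomorphisms $i\colon\mathcal V\to\mathcal B$ (injective) and $F\colon\mathcal B\to\mathcal B\otimes\mathcal A$ such that $(F\otimes\mathrm{id})F=(\mathrm{id}\otimes\phi)F$, $(\mathrm{id}\otimes\epsilon)F=\mathrm{id}$, $i(\mathcal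 V)=\{b: F(b)=b\otimes1\}$, and the action is free: $q\otimes b\mapsto (q\otimes 1)F(b)$ maps $\mathcal B\otimes\mathcal B$ onto $\mathcal B\otimes\mathcal A$. For $u\in R(G)$ let $\mathcal E_u=\mathrm{Mor}(u,F)=\{\varphi\colon H_u\to\mathcal B\text{ linear}: F\varphi=(\varphi\otimes\mathrm{id})u\}$, with $(a\varphi)(x)=i(a)\varphi(x)$ and $(\varphi a)(x)=\varphi(x)i(a)$. An arrow $f\in\mathrm M(u,v)$ induces $f^\star\colon\mathcal E_v\to\mathcal E_u$, where $f^\star(\varphi)=\varphi f$ for linear $f$, $(f^\star\varphi)(x)=\varphi(f(x))^*$ for antilinear $f$, and the two rules are added in general. Proposition. For every quantum principal $G$-bundle $P$ over $M$, the bimodules $\mathcal E_u$, the maps $f\mapsto f^\star$ and the product identifications $\vartheta$ form a representation $\tau_P$ of $R(G)$ in $\Phi_M$. Explicitly: (i) Every $\mathcal E_u$ lies in $\Phi_M$. The maps $f\mapsto f^\star$, $\mathrm M(u,v)\to\mathrm H(\mathcal E_v,\mathcal E_u)$, are grade-preserving and linear (complex-linear in degree $0$; linear in degree $1$ for the complex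 structure $T\mapsto T\circ c$ on $\overline{\mathrm H}(\mathcal E_v,\mathcal E_u)$, that is $(cf)^\star=\bar c\,f^\star$ pointwise). They define a contravariant functor: $\mathrm{id}_u^\star=\mathrm{id}$, and $(gf)^\star=f^\star g^\star$ for all $f\in\mathrm M(u,v)$, $g\in\mathrm M(v,t)$. (ii) For all $u,v$ the product of $\mathcal B$ induces a bijective bimodule homomorphism $\mathcal E_u\otimes_M\mathcal E_v\to\mathcal E_{u\times v}$, $\varphi\otimes\psi\mapsto(x\otimes y\mapsto\varphi(x)\psi(y))$. Its inverse $\vartheta_{uv}\colon\mathcal E_{u\times v}\to\mathcal E_u\otimes_M\mathcal E_v$ is natural in both degrees: $\vartheta_{up}(\varphi\otimes\psi)^\star=(\varphi^\star\otimes\psi^\star)\vartheta_{vq}$ for $\varphi\in\mathrm{Mor}(u,v)$, $\psi\in\mathrm{Mor}(p,q)$, and $\vartheta_{up}[\varphi,\psi]^\star=[\psi^\star,\varphi^\star]\vartheta_{vq}$ for $\varphi\in\overline{\mathrm M}(u,q)$, $\psi\in\overline{\mathrm M}(p,v)$. (iii) $\vartheta$ is associative: $(\vartheta_{uv}\otimes\mathrm{id})\vartheta_{u\times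 v,t}=(\mathrm{id}\otimes\vartheta_{vt})\vartheta_{u,v\times t}$ for all $u,v,t$, with the canonical identifications $(u\times v)\times t=u\times(v\times t)$ and $(\mathcal E_u\otimes_M\mathcal E_v)\otimes_M\mathcal E_t=\mathcal E_u\otimes_M(\mathcal E_v\otimes_M\mathcal E_t)$. -/

import Mathlib

open scoped TensorProduct

universe uA uB uV w x

namespace QPB

noncomputable section

/-! ### Compact matrix quantum groups -/

/-- `A` is the Hopf `*`-algebra of polynomial functions on a compact matrix quantum group: the
coproduct is a `*`-homomorphism, and `A` is generated as an algebra by the entries of one unitary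
matrix `U` with `φ(U i j) = ∑ k, U i k ⊗ U k j`. (If the group is given by a fundamental
representation whose entries generate `A` only as a `*`-algebra, take for `U` the direct sum of
that representation and of its conjugate, both brought to unitary form.) -/
structure IsCompactMatrixQuantumGroup (A : Type uA) [Ring A] [StarRing A] [HopfAlgebra ℂ A]
    [StarModule ℂ A] : Prop where
  comul_star : ∀ a : A,
    Coalgebra.comul (R := ℂ) (star a) = star (Coalgebra.comul (R := ℂ) a)
  exists_fundamental : ∃ (n : ℕ) (U : Matrix (Fin n) (Fin n) A),
    U ∈ unitary (Matrix (Fin n) (Fin n) A) ∧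
    (∀ i j, Coalgebra.comul (R := ℂ) (U i j) = ∑ k, U i k ⊗ₜ[ℂ] U k j) ∧
    Algebra.adjoin ℂ (Set.range fun p : Fin n × Fin n => U p.1 p.2) = ⊤

/-! ### The category of finite-dimensional unitary representations -/

section Coefficients

variable {A : Type uA} [Ring A] [Algebra ℂ A]
variable {H : Type w} [NormedAddCommGroup H] [InnerProductSpace ℂ H]

/-- The matrix coefficient `(⟨x, ·⟩ ⊗ id) (u y)` of a linear map `u : H → H ⊗ A`. -/
def coeff (u : H →ₗ[ℂ] H ⊗[ℂ] A) (x y : H) : A :=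
  TensorProduct.lid ℂ A ((innerₛₗ ℂ x).rTensor A (u y))

end Coefficients

/-- A unitary representation of `G` in a finite-dimensional unitary space `H`, as a right coaction
`u : H → H ⊗ A`; unitarity says that the matrix `(u i j)`, `u (e j) = ∑ i, e i ⊗ u i j`, of `u` in
an orthonormal basis is unitary. -/
structure UnitaryRep (A : Type uA) [Ring A] [StarRing A] [HopfAlgebra ℂ A] where
  H : Type w
  [normedAddCommGroup : NormedAddCommGroup H]
  [innerProductSpace : InnerProductSpace ℂ H]
  [finiteDimensional : FiniteDimensional ℂ H]
  coact : H →ₗ[ℂ] H ⊗[ℂ] A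
  coassoc : (TensorProduct.assoc ℂ H A A).toLinearMap ∘ₗ coact.rTensor A ∘ₗ coact =
    (Coalgebra.comul (R := ℂ) (A := A)).lTensor H ∘ₗ coact
  counit : (TensorProduct.rid ℂ H).toLinearMap ∘ₗ
    (Coalgebra.counit (R := ℂ) (A := A)).lTensor H ∘ₗ coact = LinearMap.id
  isUnitary : ∃ (ι : Type) (_ : Fintype ι) (_ : DecidableEq ι) (b : OrthonormalBasis ι ℂ H),
    Matrix.of (fun i j => coeff coact (b i) (b j)) ∈ unitary (Matrix ι ι A)

attribute [instance] UnitaryRep.normedAddCommGroup UnitaryRep.innerProductSpace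
  UnitaryRep.finiteDimensional

section TensorMul

variable {A : Type uA} [Ring A] [Algebra ℂ A]

/-- `(x ⊗ a) ⊗ (y ⊗ b) ↦ (x ⊗ y) ⊗ a b`. -/
def tensorMul (H K : Type w) [AddCommGroup H] [Module ℂ H] [AddCommGroup K] [Module ℂ K]
    (A : Type uA) [Ring A] [Algebra ℂ A] :
    (H ⊗[ℂ] A) ⊗[ℂ] (K ⊗[ℂ] A) →ₗ[ℂ] (H ⊗[ℂ] K) ⊗[ℂ] A :=
  (LinearMap.mul' ℂ A).lTensor (H ⊗[ℂ] K) ∘ₗ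
    (TensorProduct.tensorTensorTensorComm ℂ H A K A).toLinearMap

variable {H K : Type w} [AddCommGroup H] [Module ℂ H] [AddCommGroup K] [Module ℂ K]

@[simp] theorem tensorMul_tmul (x : H) (a : A) (y : K) (b : A) :
    tensorMul H K A ((x ⊗ₜ a) ⊗ₜ (y ⊗ₜ b)) = (x ⊗ₜ y) ⊗ₜ (a * b) := by
  simp [tensorMul]

/-- The product `u × v : x ⊗ y ↦ ∑ (x' ⊗ y') ⊗ a b` for `u x = ∑ x' ⊗ a`, `v y = ∑ y' ⊗ b`. -/
def tensorCoact (u : H →ₗ[ℂ] H ⊗[ℂ] A) (v : K →ₗ[ℂ] K ⊗[ℂ] A) :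
    H ⊗[ℂ] K →ₗ[ℂ] (H ⊗[ℂ] K) ⊗[ℂ] A :=
  tensorMul H K A ∘ₗ TensorProduct.map u v

@[simp] theorem tensorCoact_tmul (u : H →ₗ[ℂ] H ⊗[ℂ] A) (v : K →ₗ[ℂ] K ⊗[ℂ] A) (x : H) (y : K) :
    tensorCoact u v (x ⊗ₜ y) = tensorMul H K A (u x ⊗ₜ v y) := rfl

/-- Two linear maps on `(H ⊗ A) ⊗ (K ⊗ A)` agree if they agree on simple tensors. -/
theorem tensor4_ext {σ : ℂ →+* ℂ} {W : Type*} [AddCommGroup W] [Module ℂ W]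
    {f g : (H ⊗[ℂ] A) ⊗[ℂ] (K ⊗[ℂ] A) →ₛₗ[σ] W}
    (h : ∀ x a y b, f ((x ⊗ₜ a) ⊗ₜ (y ⊗ₜ b)) = g ((x ⊗ₜ a) ⊗ₜ (y ⊗ₜ b))) (z) : f z = g z := by
  induction z with
  | zero => simp
  | add p q hp hq => simp [hp, hq]
  | tmul s t =>
    induction s with
    | zero => simp
    | add p q hp hq => simp [TensorProduct.add_tmul, hp, hq]
    | tmul x a =>
      induction t with
      | zero => simp
      | add p q hp hq => simp [TensorProduct.tmul_add, hp, hq]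
      | tmul y b => exact h x a y b

end TensorMul

section CoeffTensor

variable {A : Type uA} [Ring A] [Algebra ℂ A]
variable {H K : Type w} [NormedAddCommGroup H] [InnerProductSpace ℂ H]
  [NormedAddCommGroup K] [InnerProductSpace ℂ K]

theorem coeff_tensorCoact (u : H →ₗ[ℂ] H ⊗[ℂ] A) (v : K →ₗ[ℂ] K ⊗[ℂ] A) (x x' : H) (y y' : K) :
    coeff (tensorCoact u v) (x ⊗ₜ y) (x' ⊗ₜ y') = coeff u x x' * coeff v y y' := by
  have key := tensor4_ext (A := A) (H := H) (K := K) (σ := RingHom.id ℂ)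
    (f := (TensorProduct.lid ℂ A).toLinearMap ∘ₗ (innerₛₗ ℂ (x ⊗ₜ[ℂ] y)).rTensor A ∘ₗ
      tensorMul H K A)
    (g := LinearMap.mul' ℂ A ∘ₗ TensorProduct.map
      ((TensorProduct.lid ℂ A).toLinearMap ∘ₗ (innerₛₗ ℂ x).rTensor A)
      ((TensorProduct.lid ℂ A).toLinearMap ∘ₗ (innerₛₗ ℂ y).rTensor A))
    (by intro p a q b; simp [mul_smul, smul_comm (inner ℂ x p)])
  exact key (u x' ⊗ₜ v y')

end CoeffTensor

namespace UnitaryRep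

variable {A : Type uA} [Ring A] [StarRing A] [HopfAlgebra ℂ A]

theorem tensorCoact_coassoc (u v : UnitaryRep.{uA, w} A) :
    (TensorProduct.assoc ℂ (u.H ⊗[ℂ] v.H) A A).toLinearMap ∘ₗ
        (tensorCoact u.coact v.coact).rTensor A ∘ₗ tensorCoact u.coact v.coact =
      (Coalgebra.comul (R := ℂ) (A := A)).lTensor (u.H ⊗[ℂ] v.H) ∘ₗ
        tensorCoact u.coact v.coact := by
  have h1 : ∀ (a b : A) (z : (u.H ⊗[ℂ] A) ⊗[ℂ] (v.H ⊗[ℂ] A)),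
      TensorProduct.assoc ℂ (u.H ⊗[ℂ] v.H) A A (tensorMul u.H v.H A z ⊗ₜ (a * b)) =
      tensorMul u.H v.H (A ⊗[ℂ] A) (TensorProduct.map
        ((TensorProduct.assoc ℂ u.H A A).toLinearMap ∘ₗ (TensorProduct.mk ℂ _ A).flip a)
        ((TensorProduct.assoc ℂ v.H A A).toLinearMap ∘ₗ (TensorProduct.mk ℂ _ A).flip b) z) := by
    intro a b
    exact tensor4_ext (σ := RingHom.id ℂ)
      (f := (TensorProduct.assoc ℂ (u.H ⊗[ℂ] v.H) A A).toLinearMap ∘ₗ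
        (TensorProduct.mk ℂ _ A).flip (a * b) ∘ₗ tensorMul u.H v.H A)
      (g := tensorMul u.H v.H (A ⊗[ℂ] A) ∘ₗ TensorProduct.map
        ((TensorProduct.assoc ℂ u.H A A).toLinearMap ∘ₗ (TensorProduct.mk ℂ _ A).flip a)
        ((TensorProduct.assoc ℂ v.H A A).toLinearMap ∘ₗ (TensorProduct.mk ℂ _ A).flip b))
      (by intro x a' y b'; simp)
  have h2 : ∀ z : (u.H ⊗[ℂ] A) ⊗[ℂ] (v.H ⊗[ℂ] A),
      TensorProduct.assoc ℂ (u.H ⊗[ℂ] v.H) A A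
        ((tensorCoact u.coact v.coact).rTensor A (tensorMul u.H v.H A z)) =
      tensorMul u.H v.H (A ⊗[ℂ] A) (TensorProduct.map
        ((TensorProduct.assoc ℂ u.H A A).toLinearMap ∘ₗ u.coact.rTensor A)
        ((TensorProduct.assoc ℂ v.H A A).toLinearMap ∘ₗ v.coact.rTensor A) z) := by
    refine tensor4_ext (σ := RingHom.id ℂ)
      (f := (TensorProduct.assoc ℂ (u.H ⊗[ℂ] v.H) A A).toLinearMap ∘ₗ
        (tensorCoact u.coact v.coact).rTensor A ∘ₗ tensorMul u.H v.H A)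
      (g := tensorMul u.H v.H (A ⊗[ℂ] A) ∘ₗ TensorProduct.map
        ((TensorProduct.assoc ℂ u.H A A).toLinearMap ∘ₗ u.coact.rTensor A)
        ((TensorProduct.assoc ℂ v.H A A).toLinearMap ∘ₗ v.coact.rTensor A)) ?_
    intro x a y b
    simp [h1]
  have h3 : ∀ z : (u.H ⊗[ℂ] A) ⊗[ℂ] (v.H ⊗[ℂ] A),
      (Coalgebra.comul (R := ℂ) (A := A)).lTensor (u.H ⊗[ℂ] v.H) (tensorMul u.H v.H A z) =
      tensorMul u.H v.H (A ⊗[ℂ] A) (TensorProduct.map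
        ((Coalgebra.comul (R := ℂ) (A := A)).lTensor u.H)
        ((Coalgebra.comul (R := ℂ) (A := A)).lTensor v.H) z) := by
    exact tensor4_ext (σ := RingHom.id ℂ)
      (f := (Coalgebra.comul (R := ℂ) (A := A)).lTensor (u.H ⊗[ℂ] v.H) ∘ₗ tensorMul u.H v.H A)
      (g := tensorMul u.H v.H (A ⊗[ℂ] A) ∘ₗ TensorProduct.map
        ((Coalgebra.comul (R := ℂ) (A := A)).lTensor u.H)
        ((Coalgebra.comul (R := ℂ) (A := A)).lTensor v.H))
      (by intro x a' y b'; simp)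
  refine TensorProduct.ext' fun x y => ?_
  have hu := LinearMap.congr_fun u.coassoc x
  have hv := LinearMap.congr_fun v.coassoc y
  simp only [LinearMap.comp_apply] at hu hv
  simp only [LinearMap.comp_apply, tensorCoact_tmul, h3, TensorProduct.map_tmul, ← hu, ← hv]
  exact h2 _

theorem tensorCoact_counit (u v : UnitaryRep.{uA, w} A) :
    (TensorProduct.rid ℂ (u.H ⊗[ℂ] v.H)).toLinearMap ∘ₗ
      (Coalgebra.counit (R := ℂ) (A := A)).lTensor (u.H ⊗[ℂ] v.H) ∘ₗ
        tensorCoact u.coact v.coact = LinearMap.id := by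
  have h : ∀ z : (u.H ⊗[ℂ] A) ⊗[ℂ] (v.H ⊗[ℂ] A),
      TensorProduct.rid ℂ (u.H ⊗[ℂ] v.H)
        ((Coalgebra.counit (R := ℂ) (A := A)).lTensor (u.H ⊗[ℂ] v.H) (tensorMul u.H v.H A z)) =
      TensorProduct.map
        ((TensorProduct.rid ℂ u.H).toLinearMap ∘ₗ (Coalgebra.counit (R := ℂ) (A := A)).lTensor u.H)
        ((TensorProduct.rid ℂ v.H).toLinearMap ∘ₗ (Coalgebra.counit (R := ℂ) (A := A)).lTensor v.H)
        z := by
    exact tensor4_ext (σ := RingHom.id ℂ)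
      (f := (TensorProduct.rid ℂ (u.H ⊗[ℂ] v.H)).toLinearMap ∘ₗ
        (Coalgebra.counit (R := ℂ) (A := A)).lTensor (u.H ⊗[ℂ] v.H) ∘ₗ tensorMul u.H v.H A)
      (g := TensorProduct.map
        ((TensorProduct.rid ℂ u.H).toLinearMap ∘ₗ (Coalgebra.counit (R := ℂ) (A := A)).lTensor u.H)
        ((TensorProduct.rid ℂ v.H).toLinearMap ∘ₗ (Coalgebra.counit (R := ℂ) (A := A)).lTensor v.H))
      (by intro x a' y b'
          simp only [LinearMap.comp_apply, tensorMul_tmul, LinearMap.lTensor_tmul,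
            LinearEquiv.coe_coe, TensorProduct.rid_tmul, TensorProduct.map_tmul,
            Bialgebra.counit_mul]
          rw [TensorProduct.smul_tmul_smul])
  refine TensorProduct.ext' fun x y => ?_
  have hu := LinearMap.congr_fun u.counit x
  have hv := LinearMap.congr_fun v.counit y
  simp only [LinearMap.comp_apply, LinearMap.id_apply, LinearEquiv.coe_coe] at hu hv
  simp only [LinearMap.comp_apply, tensorCoact_tmul, LinearEquiv.coe_coe, h,
    TensorProduct.map_tmul, hu, hv, LinearMap.id_apply]

theorem tensorCoact_unitary (u v : UnitaryRep.{uA, w} A) :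
    ∃ (ι : Type) (_ : Fintype ι) (_ : DecidableEq ι) (b : OrthonormalBasis ι ℂ (u.H ⊗[ℂ] v.H)),
      Matrix.of (fun i j => coeff (tensorCoact u.coact v.coact) (b i) (b j)) ∈
        unitary (Matrix ι ι A) := by
  obtain ⟨ι, _, _, b, hb1, hb2⟩ := u.isUnitary
  obtain ⟨κ, _, _, c, hc1, hc2⟩ := v.isUnitary
  refine ⟨ι × κ, inferInstance, inferInstance, b.tensorProduct c, ?_, ?_⟩
  · ext ⟨i, k⟩ ⟨j, l⟩
    have e1 := congrFun (congrFun hb1 i) j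
    have e2 := congrFun (congrFun hc1 k) l
    simp only [Matrix.mul_apply, Matrix.star_apply, Matrix.of_apply] at e1 e2
    simp only [Matrix.mul_apply, Matrix.star_apply, Matrix.of_apply,
      OrthonormalBasis.tensorProduct_apply', coeff_tensorCoact, star_mul, Fintype.sum_prod_type]
    rw [Finset.sum_comm]
    have : ∀ y x, star (coeff v.coact (c y) (c k)) * star (coeff u.coact (b x) (b i)) *
        (coeff u.coact (b x) (b j) * coeff v.coact (c y) (c l)) =
        star (coeff v.coact (c y) (c k)) * ((star (coeff u.coact (b x) (b i)) *
        coeff u.coact (b x) (b j)) * coeff v.coact (c y) (c l)) := by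
      intros; simp only [mul_assoc]
    simp only [this, ← Finset.mul_sum, ← Finset.sum_mul, e1]
    by_cases h1 : i = j <;> by_cases h2 : k = l <;> simp_all [Matrix.one_apply]
  · ext ⟨i, k⟩ ⟨j, l⟩
    have e1 := congrFun (congrFun hb2 i) j
    have e2 := congrFun (congrFun hc2 k) l
    simp only [Matrix.mul_apply, Matrix.star_apply, Matrix.of_apply] at e1 e2
    simp only [Matrix.mul_apply, Matrix.star_apply, Matrix.of_apply,
      OrthonormalBasis.tensorProduct_apply', coeff_tensorCoact, star_mul, Fintype.sum_prod_type]
    have : ∀ x y, coeff u.coact (b i) (b x) * coeff v.coact (c k) (c y) *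
        (star (coeff v.coact (c l) (c y)) * star (coeff u.coact (b j) (b x))) =
        coeff u.coact (b i) (b x) * ((coeff v.coact (c k) (c y) *
        star (coeff v.coact (c l) (c y))) * star (coeff u.coact (b j) (b x))) := by
      intros; simp only [mul_assoc]
    simp only [this, ← Finset.mul_sum, ← Finset.sum_mul, e2]
    by_cases h1 : i = j <;> by_cases h2 : k = l <;> simp_all [Matrix.one_apply]

/-- The product `u × v` in `R(G)`, acting in `H_u ⊗ H_v`. -/
def tensor (u v : UnitaryRep.{uA, w} A) : UnitaryRep.{uA, w} A where
  H := u.H ⊗[ℂ] v.H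
  coact := tensorCoact u.coact v.coact
  coassoc := tensorCoact_coassoc u v
  counit := tensorCoact_counit u v
  isUnitary := tensorCoact_unitary u v

/-- `Mor(u, v)`: the linear intertwiners. -/
def Mor (u v : UnitaryRep.{uA, w} A) : Submodule ℂ (u.H →ₗ[ℂ] v.H) where
  carrier := {f | ∀ x, v.coact (f x) = f.rTensor A (u.coact x)}
  add_mem' {f g} hf hg x := by
    simp only [Set.mem_ofPred_eq] at *
    simp [LinearMap.rTensor_add, hf, hg]
  zero_mem' x := by simp
  smul_mem' c f hf x := by
    simp only [Set.mem_ofPred_eq] at *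
    simp [LinearMap.rTensor_smul, hf]

variable [StarModule ℂ A]

/-- The antilinear morphisms from `u` to `v`: antilinear `f` with `v f = (f ⊗ *) u`. -/
def AMor (u v : UnitaryRep.{uA, w} A) : Submodule ℂ (u.H →ₗ⋆[ℂ] v.H) where
  carrier := {f | ∀ x, v.coact (f x) =
    TensorProduct.map f (starLinearEquiv ℂ (A := A)).toLinearMap (u.coact x)}
  add_mem' {f g} hf hg x := by
    simp only [Set.mem_ofPred_eq] at *
    simp [TensorProduct.map_add_left, hf, hg]
  zero_mem' x := by simp
  smul_mem' c f hf x := by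
    simp only [Set.mem_ofPred_eq] at *
    simp [TensorProduct.map_smul_left, hf]

/-- The `ℤ/2`-graded arrows `M(u, v)` of `R(G)`: the sum of the space of linear and the space of
antilinear morphisms. -/
abbrev M (u v : UnitaryRep.{uA, w} A) := Mor u v × AMor u v

section Composition

variable {t u v : UnitaryRep.{uA, w} A}

/-- Composition of arrows in `R(G)`. -/
def M.comp (g : M u v) (f : M t u) : M t v :=
  (⟨g.1.1.comp f.1.1 + g.2.1.comp f.2.1, by
      refine Submodule.add_mem _ (fun x => ?_) (fun x => ?_)
      · have hf := f.1.2 x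
        have hg := g.1.2 (f.1.1 x)
        rw [LinearMap.comp_apply, hg, hf, LinearMap.rTensor_comp, LinearMap.comp_apply]
      · have hf := f.2.2 x
        have hg := g.2.2 (f.2.1 x)
        rw [LinearMap.comp_apply, hg, hf, TensorProduct.map_map, LinearMap.rTensor]
        congr 2
        ext a; simp⟩,
   ⟨g.1.1.comp f.2.1 + g.2.1.comp f.1.1, by
      refine Submodule.add_mem _ (fun x => ?_) (fun x => ?_)
      · have hf := f.2.2 x
        have hg := g.1.2 (f.2.1 x)
        rw [LinearMap.comp_apply, hg, hf, LinearMap.rTensor, TensorProduct.map_map]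
        congr 2
      · have hf := f.1.2 x
        have hg := g.2.2 (f.1.1 x)
        rw [LinearMap.comp_apply, hg, hf, LinearMap.rTensor, TensorProduct.map_map]
        congr 2⟩)

/-- The identity arrow. -/
def M.id (u : UnitaryRep.{uA, w} A) : M u u :=
  (⟨LinearMap.id, fun x => by simp⟩, 0)

end Composition

section TensorArrows

variable {u p v q t : UnitaryRep.{uA, w} A}

/-- `φ ⊗ ψ` for linear morphisms. -/
def morTensor (φ : Mor u v) (ψ : Mor p q) : Mor (u.tensor p) (v.tensor q) :=
  ⟨TensorProduct.map φ.1 ψ.1, by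
    have h : ∀ z : (u.H ⊗[ℂ] A) ⊗[ℂ] (p.H ⊗[ℂ] A),
        tensorMul v.H q.H A (TensorProduct.map (φ.1.rTensor A) (ψ.1.rTensor A) z) =
        (TensorProduct.map φ.1 ψ.1).rTensor A (tensorMul u.H p.H A z) :=
      tensor4_ext (σ := RingHom.id ℂ)
        (f := tensorMul v.H q.H A ∘ₗ TensorProduct.map (φ.1.rTensor A) (ψ.1.rTensor A))
        (g := (TensorProduct.map φ.1 ψ.1).rTensor A ∘ₗ tensorMul u.H p.H A)
        (by intro x a y b; simp)
    have h' : tensorCoact v.coact q.coact ∘ₗ TensorProduct.map φ.1 ψ.1 =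
        (TensorProduct.map φ.1 ψ.1).rTensor A ∘ₗ tensorCoact u.coact p.coact := by
      refine TensorProduct.ext' fun x y => ?_
      simp only [LinearMap.comp_apply, tensorCoact_tmul, TensorProduct.map_tmul, ← h]
      rw [φ.2 x, ψ.2 y]
    exact fun z => LinearMap.congr_fun h' z⟩

/-- The twisted tensor product `[φ, ψ] : x ⊗ y ↦ ψ y ⊗ φ x` of antilinear morphisms. -/
def amorTwist (φ : AMor u q) (ψ : AMor p v) : AMor (u.tensor p) (v.tensor q) :=
  ⟨(TensorProduct.comm ℂ q.H v.H).toLinearMap.comp (TensorProduct.map φ.1 ψ.1), by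
    have h : ∀ z : (u.H ⊗[ℂ] A) ⊗[ℂ] (p.H ⊗[ℂ] A),
        tensorMul v.H q.H A (TensorProduct.comm ℂ _ _ (TensorProduct.map
          (TensorProduct.map φ.1 (starLinearEquiv ℂ (A := A)).toLinearMap)
          (TensorProduct.map ψ.1 (starLinearEquiv ℂ (A := A)).toLinearMap) z)) =
        TensorProduct.map ((TensorProduct.comm ℂ q.H v.H).toLinearMap.comp
          (TensorProduct.map φ.1 ψ.1)) (starLinearEquiv ℂ (A := A)).toLinearMap
          (tensorMul u.H p.H A z) :=
      tensor4_ext (σ := starRingEnd ℂ)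
        (f := (tensorMul v.H q.H A ∘ₗ (TensorProduct.comm ℂ _ _).toLinearMap).comp
          (TensorProduct.map
            (TensorProduct.map φ.1 (starLinearEquiv ℂ (A := A)).toLinearMap)
            (TensorProduct.map ψ.1 (starLinearEquiv ℂ (A := A)).toLinearMap)))
        (g := (TensorProduct.map ((TensorProduct.comm ℂ q.H v.H).toLinearMap.comp
          (TensorProduct.map φ.1 ψ.1)) (starLinearEquiv ℂ (A := A)).toLinearMap).comp
          (tensorMul u.H p.H A))
        (by intro x a y b; simp)
    have h' : (tensorCoact v.coact q.coact).comp
          ((TensorProduct.comm ℂ q.H v.H).toLinearMap.comp (TensorProduct.map φ.1 ψ.1)) =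
        (TensorProduct.map ((TensorProduct.comm ℂ q.H v.H).toLinearMap.comp
          (TensorProduct.map φ.1 ψ.1)) (starLinearEquiv ℂ (A := A)).toLinearMap).comp
          (tensorCoact u.coact p.coact) := by
      refine TensorProduct.ext' fun x y => ?_
      simp only [LinearMap.comp_apply, tensorCoact_tmul, TensorProduct.map_tmul, ← h,
        LinearEquiv.coe_coe, TensorProduct.comm_tmul]
      rw [φ.2 x, ψ.2 y]
    exact fun z => LinearMap.congr_fun h' z⟩

/-- The canonical identification `(u × v) × t → u × (v × t)`. -/
def assocMor (u v t : UnitaryRep.{uA, w} A) :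
    Mor ((u.tensor v).tensor t) (u.tensor (v.tensor t)) :=
  ⟨(TensorProduct.assoc ℂ u.H v.H t.H).toLinearMap, by
    have h1 : ∀ (y : t.H) (c : A) (z : (u.H ⊗[ℂ] A) ⊗[ℂ] (v.H ⊗[ℂ] A)),
        (TensorProduct.assoc ℂ u.H v.H t.H).toLinearMap.rTensor A
          (tensorMul (u.H ⊗[ℂ] v.H) t.H A (tensorMul u.H v.H A z ⊗ₜ (y ⊗ₜ c))) =
        tensorMul u.H (v.H ⊗[ℂ] t.H) A ((tensorMul v.H t.H A).lTensor (u.H ⊗[ℂ] A)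
          (TensorProduct.assoc ℂ _ _ _ (z ⊗ₜ (y ⊗ₜ c)))) := by
      intro y c
      exact tensor4_ext (σ := RingHom.id ℂ)
        (f := (TensorProduct.assoc ℂ u.H v.H t.H).toLinearMap.rTensor A ∘ₗ
          tensorMul (u.H ⊗[ℂ] v.H) t.H A ∘ₗ (TensorProduct.mk ℂ _ _).flip (y ⊗ₜ c) ∘ₗ
          tensorMul u.H v.H A)
        (g := tensorMul u.H (v.H ⊗[ℂ] t.H) A ∘ₗ (tensorMul v.H t.H A).lTensor (u.H ⊗[ℂ] A) ∘ₗ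
          (TensorProduct.assoc ℂ _ _ _).toLinearMap ∘ₗ (TensorProduct.mk ℂ _ _).flip (y ⊗ₜ c))
        (by intro x a y b; simp [mul_assoc])
    have h2 : ∀ (z : (u.H ⊗[ℂ] A) ⊗[ℂ] (v.H ⊗[ℂ] A)) (r : t.H ⊗[ℂ] A),
        (TensorProduct.assoc ℂ u.H v.H t.H).toLinearMap.rTensor A
          (tensorMul (u.H ⊗[ℂ] v.H) t.H A (tensorMul u.H v.H A z ⊗ₜ r)) =
        tensorMul u.H (v.H ⊗[ℂ] t.H) A ((tensorMul v.H t.H A).lTensor (u.H ⊗[ℂ] A)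
          (TensorProduct.assoc ℂ _ _ _ (z ⊗ₜ r))) := by
      intro z r
      induction r with
      | zero => simp
      | add a b ha hb => simp only [TensorProduct.tmul_add, map_add, ha, hb]
      | tmul y c => exact h1 y c z
    have h' : tensorCoact u.coact (tensorCoact v.coact t.coact) ∘ₗ
          (TensorProduct.assoc ℂ u.H v.H t.H).toLinearMap =
        (TensorProduct.assoc ℂ u.H v.H t.H).toLinearMap.rTensor A ∘ₗ
          tensorCoact (tensorCoact u.coact v.coact) t.coact := by
      refine TensorProduct.ext_threefold fun x y z => ?_
      simp [h2]
    exact fun z => LinearMap.congr_fun h' z⟩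

end TensorArrows

end UnitaryRep

/-! ### Bimodules over a `*`-algebra -/

/-- A bimodule over a complex algebra `V`; the right action is an action of `Vᵐᵒᵖ`. -/
structure Bimodule (V : Type uV) [Ring V] [Algebra ℂ V] where
  carrier : Type x
  [addCommGroup : AddCommGroup carrier]
  [complexModule : Module ℂ carrier]
  [leftModule : Module V carrier]
  [rightModule : Module Vᵐᵒᵖ carrier]
  [leftTower : IsScalarTower ℂ V carrier]
  [rightTower : IsScalarTower ℂ Vᵐᵒᵖ carrier]
  [smulComm : SMulCommClass V Vᵐᵒᵖ carrier]

attribute [instance] Bimodule.addCommGroup Bimodule.complexModule Bimodule.leftModule Bimodule.rightModule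
  Bimodule.leftTower Bimodule.rightTower Bimodule.smulComm

namespace Bimodule

open MulOpposite

variable {V : Type uV} [Ring V] [Algebra ℂ V]

/-- Finite projective bimodules: finitely generated and projective on both sides. -/
structure IsFiniteProjective (J : Bimodule.{uV, x} V) : Prop where
  finite_left : Module.Finite V J.carrier
  projective_left : Module.Projective V J.carrier
  finite_right : Module.Finite Vᵐᵒᵖ J.carrier
  projective_right : Module.Projective Vᵐᵒᵖ J.carrier

instance (J : Bimodule.{uV, x} V) : SMulCommClass ℂ V J.carrier := IsScalarTower.to_smulCommClass

instance (J : Bimodule.{uV, x} V) : SMulCommClass ℂ Vᵐᵒᵖ J.carrier :=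
  IsScalarTower.to_smulCommClass

/-- Bimodule homomorphisms. -/
def Hom (J K : Bimodule.{uV, x} V) : Submodule ℂ (J.carrier →ₗ[ℂ] K.carrier) where
  carrier := {T | (∀ (a : V) j, T (a • j) = a • T j) ∧ ∀ (a : V) j, T (op a • j) = op a • T j}
  add_mem' {S T} hS hT := by
    simp only [Set.mem_ofPred_eq] at *
    simp [hS, hT]
  zero_mem' := by simp
  smul_mem' c T hT := by
    simp only [Set.mem_ofPred_eq] at *
    simp [hT, smul_comm c]

section Anti

variable [StarRing V]

/-- Antilinear bimodule antihomomorphisms: `T (a j) = T j a*` and `T (j a) = a* T j`. -/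
def AHom (J K : Bimodule.{uV, x} V) : Submodule ℂ (J.carrier →ₗ⋆[ℂ] K.carrier) where
  carrier := {T | (∀ (a : V) j, T (a • j) = op (star a) • T j) ∧
    ∀ (a : V) j, T (op a • j) = star a • T j}
  add_mem' {S T} hS hT := by
    simp only [Set.mem_ofPred_eq] at *
    simp [hS, hT]
  zero_mem' := by simp
  smul_mem' c T hT := by
    simp only [Set.mem_ofPred_eq] at *
    simp [hT, smul_comm c]

/-- The `ℤ/2`-graded arrows `H(J, K)`. -/
abbrev GHom (J K : Bimodule.{uV, x} V) := Hom J K × AHom J K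

variable {J K L : Bimodule.{uV, x} V}

/-- Composition of graded arrows. -/
def GHom.comp (T : GHom K L) (S : GHom J K) : GHom J L :=
  (⟨T.1.1.comp S.1.1 + T.2.1.comp S.2.1, by
      refine Submodule.add_mem _ ⟨fun a j => ?_, fun a j => ?_⟩ ⟨fun a j => ?_, fun a j => ?_⟩
      · simp [S.1.2.1, T.1.2.1]
      · simp [S.1.2.2, T.1.2.2]
      · rw [LinearMap.comp_apply, S.2.2.1, T.2.2.2, star_star]; rfl
      · rw [LinearMap.comp_apply, S.2.2.2, T.2.2.1, star_star]; rfl⟩,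
   ⟨T.1.1.comp S.2.1 + T.2.1.comp S.1.1, by
      refine Submodule.add_mem _ ⟨fun a j => ?_, fun a j => ?_⟩ ⟨fun a j => ?_, fun a j => ?_⟩
      · rw [LinearMap.comp_apply, S.2.2.1, T.1.2.2]; rfl
      · rw [LinearMap.comp_apply, S.2.2.2, T.1.2.1]; rfl
      · simp [S.1.2.1, T.2.2.1]
      · simp [S.1.2.2, T.2.2.2]⟩)

/-- The identity arrow. -/
def GHom.id (J : Bimodule.{uV, x} V) : GHom J J := (⟨LinearMap.id, by simp [Hom]⟩, 0)

end Anti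

/-! #### The tensor product over `V` -/

/-- The relations `j a ⊗ k = j ⊗ a k`. -/
def rel (J K : Bimodule.{uV, x} V) : Submodule ℂ (J.carrier ⊗[ℂ] K.carrier) :=
  Submodule.span ℂ (Set.range fun p : J.carrier × V × K.carrier =>
    (op p.2.1 • p.1) ⊗ₜ[ℂ] p.2.2 - p.1 ⊗ₜ[ℂ] (p.2.1 • p.2.2))

theorem rel_le {J K : Bimodule.{uV, x} V} {W : Type*} [AddCommGroup W] [Module ℂ W] {σ : ℂ →+* ℂ}
    [RingHomSurjective σ] (f : J.carrier ⊗[ℂ] K.carrier →ₛₗ[σ] W) (N : Submodule ℂ W)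
    (h : ∀ j (a : V) k, f ((op a • j) ⊗ₜ k) - f (j ⊗ₜ (a • k)) ∈ N) : rel J K ≤ N.comap f := by
  rw [rel, Submodule.span_le]
  rintro _ ⟨⟨j, a, k⟩, rfl⟩
  simpa using h j a k

/-- The underlying space of `J ⊗_V K`. -/
abbrev TensorCarrier (J K : Bimodule.{uV, x} V) := (J.carrier ⊗[ℂ] K.carrier) ⧸ rel J K

/-- The class of `j ⊗ k` in `J ⊗_V K`. -/
def tmul {J K : Bimodule.{uV, x} V} (j : J.carrier) (k : K.carrier) : TensorCarrier J K :=
  (rel J K).mkQ (j ⊗ₜ k)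

theorem tmul_smul {J K : Bimodule.{uV, x} V} (j : J.carrier) (a : V) (k : K.carrier) :
    tmul j (a • k) = tmul (op a • j) k := by
  refine ((Submodule.Quotient.eq _).2 ?_).symm
  exact Submodule.subset_span ⟨(j, a, k), rfl⟩

theorem tensor_ext {J K : Bimodule.{uV, x} V} {W : Type*} [AddCommGroup W] [Module ℂ W]
    {σ : ℂ →+* ℂ} {f g : TensorCarrier J K →ₛₗ[σ] W}
    (h : ∀ j k, f (tmul j k) = g (tmul j k)) (z) : f z = g z := by
  obtain ⟨z, rfl⟩ := Submodule.mkQ_surjective _ z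
  induction z with
  | zero => simp
  | add p q hp hq => simp only [map_add, hp, hq]
  | tmul j k => exact h j k

/-- `a • (j ⊗ k) = (a j) ⊗ k`. -/
def leftAct (J K : Bimodule.{uV, x} V) (a : V) : TensorCarrier J K →ₗ[ℂ] TensorCarrier J K :=
  (rel J K).mapQ (rel J K) ((Algebra.lsmul ℂ ℂ J.carrier a).rTensor K.carrier)
    (rel_le _ _ fun j b k => by
      simp only [LinearMap.rTensor_tmul, Algebra.lsmul_coe]
      rw [smul_comm]
      exact Submodule.subset_span ⟨(a • j, b, k), rfl⟩)

/-- `(j ⊗ k) • a = j ⊗ (k a)`. -/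
def rightAct (J K : Bimodule.{uV, x} V) (a : Vᵐᵒᵖ) : TensorCarrier J K →ₗ[ℂ] TensorCarrier J K :=
  (rel J K).mapQ (rel J K) ((Algebra.lsmul ℂ ℂ K.carrier a).lTensor J.carrier)
    (rel_le _ _ fun j b k => by
      simp only [LinearMap.lTensor_tmul, Algebra.lsmul_coe]
      rw [← smul_comm b a k]
      exact Submodule.subset_span ⟨(j, b, a • k), rfl⟩)

@[simp] theorem leftAct_tmul {J K : Bimodule.{uV, x} V} (a : V) (j : J.carrier) (k : K.carrier) :
    leftAct J K a (tmul j k) = tmul (a • j) k := rfl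

@[simp] theorem rightAct_tmul {J K : Bimodule.{uV, x} V} (a : Vᵐᵒᵖ) (j : J.carrier)
    (k : K.carrier) : rightAct J K a (tmul j k) = tmul j (a • k) := rfl

theorem add_tmul {J K : Bimodule.{uV, x} V} (j j' : J.carrier) (k : K.carrier) :
    tmul (j + j') k = tmul j k + tmul j' k := by
  simp [tmul, TensorProduct.add_tmul]

theorem tmul_add {J K : Bimodule.{uV, x} V} (j : J.carrier) (k k' : K.carrier) :
    tmul j (k + k') = tmul j k + tmul j k' := by
  simp [tmul, TensorProduct.tmul_add]

theorem smul_tmul {J K : Bimodule.{uV, x} V} (c : ℂ) (j : J.carrier) (k : K.carrier) :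
    tmul (c • j) k = c • tmul j k := rfl

theorem tmul_smul_complex {J K : Bimodule.{uV, x} V} (c : ℂ) (j : J.carrier) (k : K.carrier) :
    tmul j (c • k) = c • tmul j k := by
  simp [tmul]

/-- The left module structure of `J ⊗_V K`. -/
abbrev tensorLeft (J K : Bimodule.{uV, x} V) : Module V (TensorCarrier J K) where
  smul a z := leftAct J K a z
  one_smul := tensor_ext (σ := RingHom.id ℂ) (f := leftAct J K 1) (g := LinearMap.id)
    (by simp)
  mul_smul a b := tensor_ext (σ := RingHom.id ℂ) (f := leftAct J K (a * b))
    (g := leftAct J K a ∘ₗ leftAct J K b) (by simp [mul_smul])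
  smul_zero a := map_zero (leftAct J K a)
  smul_add a := map_add (leftAct J K a)
  add_smul a b := tensor_ext (σ := RingHom.id ℂ) (f := leftAct J K (a + b))
    (g := leftAct J K a + leftAct J K b) (by simp [add_smul, add_tmul])
  zero_smul := tensor_ext (σ := RingHom.id ℂ) (f := leftAct J K 0) (g := 0)
    (fun j k => by rw [leftAct_tmul, zero_smul]; simp [tmul])

/-- The right module structure of `J ⊗_V K`. -/
abbrev tensorRight (J K : Bimodule.{uV, x} V) : Module Vᵐᵒᵖ (TensorCarrier J K) where
  smul a z := rightAct J K a z
  one_smul := tensor_ext (σ := RingHom.id ℂ) (f := rightAct J K 1) (g := LinearMap.id)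
    (by simp)
  mul_smul a b := tensor_ext (σ := RingHom.id ℂ) (f := rightAct J K (a * b))
    (g := rightAct J K a ∘ₗ rightAct J K b) (by simp [mul_smul])
  smul_zero a := map_zero (rightAct J K a)
  smul_add a := map_add (rightAct J K a)
  add_smul a b := tensor_ext (σ := RingHom.id ℂ) (f := rightAct J K (a + b))
    (g := rightAct J K a + rightAct J K b) (by simp [add_smul, tmul_add])
  zero_smul := tensor_ext (σ := RingHom.id ℂ) (f := rightAct J K 0) (g := 0)
    (fun j k => by rw [rightAct_tmul, zero_smul]; simp [tmul])

/-- The bimodule `J ⊗_V K`, that is `J ⊗_M K` when `V` represents the quantum space `M`. -/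
def tensor (J K : Bimodule.{uV, x} V) : Bimodule.{uV, x} V where
  carrier := TensorCarrier J K
  leftModule := tensorLeft J K
  rightModule := tensorRight J K
  leftTower := by
    let _ := tensorLeft J K
    refine ⟨fun c a => ?_⟩
    exact tensor_ext (σ := RingHom.id ℂ) (f := leftAct J K (c • a)) (g := c • leftAct J K a)
      (by simp [smul_tmul])
  rightTower := by
    let _ := tensorRight J K
    refine ⟨fun c a => ?_⟩
    exact tensor_ext (σ := RingHom.id ℂ) (f := rightAct J K (c • a)) (g := c • rightAct J K a)
      (by simp [tmul_smul_complex])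
  smulComm := by
    let _ := tensorLeft J K
    let _ := tensorRight J K
    refine ⟨fun a b => ?_⟩
    exact tensor_ext (σ := RingHom.id ℂ) (f := leftAct J K a ∘ₗ rightAct J K b)
      (g := rightAct J K b ∘ₗ leftAct J K a) (by simp)

section TensorMaps

variable {J K J' K' L : Bimodule.{uV, x} V}

/-- `S ⊗ T : j ⊗ k ↦ S j ⊗ T k` for bimodule homomorphisms. -/
def homTensor (S : Hom J J') (T : Hom K K') : Hom (J.tensor K) (J'.tensor K') :=
  let f : TensorCarrier J K →ₗ[ℂ] TensorCarrier J' K' :=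
    (rel J K).mapQ (rel J' K') (TensorProduct.map S.1 T.1) (rel_le _ _ fun j a k => by
      simp only [TensorProduct.map_tmul, S.2.2, T.2.1]
      exact Submodule.subset_span ⟨(S.1 j, a, T.1 k), rfl⟩)
  ⟨f, fun a => tensor_ext (σ := RingHom.id ℂ) (f := f ∘ₗ leftAct J K a)
      (g := leftAct J' K' a ∘ₗ f) (fun j k => congrArg (tmul · (T.1 k)) (S.2.1 a j)),
    fun a => tensor_ext (σ := RingHom.id ℂ) (f := f ∘ₗ rightAct J K (op a))
      (g := rightAct J' K' (op a) ∘ₗ f) (fun j k => congrArg (tmul (S.1 j) ·) (T.2.2 a k))⟩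

/-- The identity homomorphism. -/
def homId (J : Bimodule.{uV, x} V) : Hom J J := ⟨LinearMap.id, by simp [Hom]⟩

/-- The twisted tensor product `[S, T] : j ⊗ k ↦ T k ⊗ S j` of antilinear antihomomorphisms. -/
def ahomTwist [StarRing V] (S : AHom J K') (T : AHom K J') :
    AHom (J.tensor K) (J'.tensor K') :=
  let f : TensorCarrier J K →ₗ⋆[ℂ] TensorCarrier J' K' :=
    (rel J K).mapQ (rel J' K') ((TensorProduct.comm ℂ _ _).toLinearMap.comp
      (TensorProduct.map S.1 T.1)) (rel_le _ _ fun j a k => by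
      simp only [LinearMap.comp_apply, TensorProduct.map_tmul, S.2.2, T.2.1,
        LinearEquiv.coe_coe, TensorProduct.comm_tmul]
      rw [← Submodule.neg_mem_iff, neg_sub]
      exact Submodule.subset_span ⟨(T.1 k, star a, S.1 j), rfl⟩)
  ⟨f, fun a => tensor_ext (σ := starRingEnd ℂ) (f := f.comp (leftAct J K a))
      (g := (rightAct J' K' (op (star a))).comp f)
      (fun j k => congrArg (tmul (T.1 k) ·) (S.2.1 a j)),
    fun a => tensor_ext (σ := starRingEnd ℂ) (f := f.comp (rightAct J K (op a)))
      (g := (leftAct J' K' (star a)).comp f)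
      (fun j k => congrArg (tmul · (S.1 j)) (T.2.2 a k))⟩

/-- The bimodule homomorphism `J ⊗_V K → L` induced by a balanced bilinear bimodule map. -/
def homLift (f : J.carrier →ₗ[ℂ] K.carrier →ₗ[ℂ] L.carrier)
    (hb : ∀ j (a : V) k, f (op a • j) k = f j (a • k))
    (hl : ∀ (a : V) j k, f (a • j) k = a • f j k)
    (hr : ∀ (a : V) j k, f j (op a • k) = op a • f j k) : Hom (J.tensor K) L :=
  let g : TensorCarrier J K →ₗ[ℂ] L.carrier :=
    (rel J K).liftQ (TensorProduct.lift f) (rel_le _ ⊥ fun j a k => by simp [hb])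
  ⟨g, fun a => tensor_ext (σ := RingHom.id ℂ) (f := g ∘ₗ leftAct J K a)
      (g := Algebra.lsmul ℂ ℂ L.carrier a ∘ₗ g) (fun j k => hl a j k),
    fun a => tensor_ext (σ := RingHom.id ℂ) (f := g ∘ₗ rightAct J K (op a))
      (g := Algebra.lsmul ℂ ℂ L.carrier (op a) ∘ₗ g) (fun j k => hr a j k)⟩

/-- The bilinear map `(j ⊗ k, l) ↦ j ⊗ (k ⊗ l)`. -/
def assocBil (J K L : Bimodule.{uV, x} V) :
    TensorCarrier J K →ₗ[ℂ] L.carrier →ₗ[ℂ] TensorCarrier J (K.tensor L) :=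
  (rel J K).liftQ (TensorProduct.curry ((rel J (K.tensor L)).mkQ ∘ₗ
      (rel K L).mkQ.lTensor J.carrier ∘ₗ
      (TensorProduct.assoc ℂ J.carrier K.carrier L.carrier).toLinearMap))
    (rel_le _ ⊥ fun j a k => by
      rw [Submodule.mem_bot, sub_eq_zero]
      ext l
      exact (tmul_smul (J := J) (K := K.tensor L) j a (tmul k l)).symm)

/-- The canonical identification `(J ⊗_V K) ⊗_V L → J ⊗_V (K ⊗_V L)`. -/
def assocHom (J K L : Bimodule.{uV, x} V) :
    Hom ((J.tensor K).tensor L) (J.tensor (K.tensor L)) :=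
  homLift (J := J.tensor K) (K := L) (L := J.tensor (K.tensor L)) (assocBil J K L)
    (fun z a l => tensor_ext (σ := RingHom.id ℂ)
      (f := (assocBil J K L).flip l ∘ₗ rightAct J K (op a))
      (g := (assocBil J K L).flip (a • l))
      (fun j k => congrArg (tmul (J := J) (K := K.tensor L) j ·) (tmul_smul k a l).symm) z)
    (fun a z l => tensor_ext (σ := RingHom.id ℂ)
      (f := (assocBil J K L).flip l ∘ₗ leftAct J K a)
      (g := leftAct J (K.tensor L) a ∘ₗ (assocBil J K L).flip l)
      (fun _ _ => rfl) z)
    (fun a z l => tensor_ext (σ := RingHom.id ℂ)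
      (f := (assocBil J K L).flip (op a • l))
      (g := rightAct J (K.tensor L) (op a) ∘ₗ (assocBil J K L).flip l)
      (fun _ _ => rfl) z)

theorem assocHom_tmul (J K L : Bimodule.{uV, x} V) (j : J.carrier) (k : K.carrier) (l : L.carrier) :
    (assocHom J K L).1 (tmul (J := J.tensor K) (K := L) (tmul j k) l) =
      tmul (J := J) (K := K.tensor L) j (tmul k l) := rfl

end TensorMaps

end Bimodule

/-! ### Representations of `R(G)` in `Φ_M` -/

section Representation

open UnitaryRep Bimodule

variable {A : Type uA} [Ring A] [StarRing A] [HopfAlgebra ℂ A] [StarModule ℂ A]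
variable {V : Type uV} [Ring V] [Algebra ℂ V] [StarRing V]

/-- The system of maps `M(u, v) → H(E_v, E_u)` with given components of degree `0` and `1`. -/
def gradedMap {E : UnitaryRep.{uA, w} A → Bimodule.{uV, x} V}
    (lin : ∀ u v, Mor u v →ₗ[ℂ] Hom (E v) (E u))
    (anti : ∀ u v, AMor u v →ₗ⋆[ℂ] AHom (E v) (E u))
    {u v : UnitaryRep.{uA, w} A} (f : M u v) : GHom (E v) (E u) :=
  (lin u v f.1, anti u v f.2)

/-- The data `E`, `lin`, `anti`, `ϑ` are a representation of `R(G)` in the category `Φ_M` of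
finite projective `V`-bimodules. The arrow `f* : E_v → E_u` associated with `f ∈ M(u, v)` is given
in degree `0` by `lin` and in degree `1` by `anti`. For antilinear `f`, functoriality forces
`(c f)* = (c id ∘ f)* = f* ∘ (c id)* = f* ∘ c`; so in degree `1` linearity refers to the complex
structure `T ↦ T ∘ c` on the antilinear maps `T : E_v → E_u`, which means conjugate-linearity for
the pointwise structure `T ↦ c ∘ T` of the type `AHom`. -/
structure IsRepresentation (E : UnitaryRep.{uA, w} A → Bimodule.{uV, x} V)
    (lin : ∀ u v, Mor u v →ₗ[ℂ] Hom (E v) (E u))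
    (anti : ∀ u v, AMor u v →ₗ⋆[ℂ] AHom (E v) (E u))
    (ϑ : ∀ u v : UnitaryRep.{uA, w} A, Hom (E (u.tensor v)) ((E u).tensor (E v))) : Prop where
  /-- the objects lie in `Φ_M` -/
  finite_projective : ∀ u, (E u).IsFiniteProjective
  /-- contravariant functoriality on all graded arrows -/
  map_id : ∀ u, gradedMap lin anti (M.id u) = GHom.id (E u)
  map_comp : ∀ {u v t : UnitaryRep.{uA, w} A} (g : M v t) (f : M u v),
    gradedMap lin anti (g.comp f) = (gradedMap lin anti f).comp (gradedMap lin anti g)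
  /-- `ϑ` consists of bimodule isomorphisms -/
  bijective : ∀ u v, Function.Bijective (ϑ u v).1
  /-- naturality for the degree `0` arrows `(φ, ψ) : (u, p) → (v, q)` -/
  natural : ∀ {u p v q : UnitaryRep.{uA, w} A} (φ : Mor u v) (ψ : Mor p q)
    (ξ : (E (v.tensor q)).carrier),
    (ϑ u p).1 ((lin _ _ (morTensor φ ψ)).1 ξ) =
      (homTensor (lin u v φ) (lin p q ψ)).1 ((ϑ v q).1 ξ)
  /-- naturality for the degree `1` arrows `(φ, ψ) : (u, p) → (v, q)` -/
  natural_anti : ∀ {u p v q : UnitaryRep.{uA, w} A} (φ : AMor u q) (ψ : AMor p v)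
    (ξ : (E (v.tensor q)).carrier),
    (ϑ u p).1 ((anti _ _ (amorTwist φ ψ)).1 ξ) =
      (ahomTwist (anti p v ψ) (anti u q φ)).1 ((ϑ v q).1 ξ)
  /-- associativity `(ϑ ⊗ id) ϑ = (id ⊗ ϑ) ϑ`, modulo the canonical identifications -/
  assoc : ∀ (u v t : UnitaryRep.{uA, w} A) (ξ : (E (u.tensor (v.tensor t))).carrier),
    (assocHom (E u) (E v) (E t)).1 ((homTensor (ϑ u v) (homId (E t))).1
        ((ϑ (u.tensor v) t).1 ((lin _ _ (assocMor u v t)).1 ξ))) =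
      (homTensor (homId (E u)) (ϑ v t)).1 ((ϑ u (v.tensor t)).1 ξ)

end Representation

/-! ### Quantum principal bundles and their intertwiner bimodules -/

section Multiplication

variable {A : Type uA} [Ring A] [Algebra ℂ A] {B : Type uB} [Ring B] [Algebra ℂ B]

theorem rTensor_mulLeft {H : Type w} [AddCommGroup H] [Module ℂ H] (b : B) (φ : H →ₗ[ℂ] B)
    (z : H ⊗[ℂ] A) :
    (LinearMap.mulLeft ℂ b ∘ₗ φ).rTensor A z = (b ⊗ₜ 1) * φ.rTensor A z := by
  induction z with
  | zero => simp
  | add p q hp hq => simp only [map_add, mul_add, hp, hq]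
  | tmul x a => simp

theorem rTensor_mulRight {H : Type w} [AddCommGroup H] [Module ℂ H] (b : B) (φ : H →ₗ[ℂ] B)
    (z : H ⊗[ℂ] A) :
    (LinearMap.mulRight ℂ b ∘ₗ φ).rTensor A z = φ.rTensor A z * (b ⊗ₜ 1) := by
  induction z with
  | zero => simp
  | add p q hp hq => simp only [map_add, add_mul, hp, hq]
  | tmul x a => simp

end Multiplication

section Bundle

open UnitaryRep Bimodule MulOpposite

/-- A quantum principal `G`-bundle `P = (B, i, F)` over the quantum space represented by `V`. -/
structure QuantumPrincipalBundle (A : Type uA) (V : Type uV) (B : Type uB)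
    [Ring A] [StarRing A] [HopfAlgebra ℂ A] [StarModule ℂ A]
    [Ring V] [Algebra ℂ V] [StarRing V] [StarModule ℂ V]
    [Ring B] [Algebra ℂ B] [StarRing B] [StarModule ℂ B] where
  i : V →⋆ₐ[ℂ] B
  F : B →⋆ₐ[ℂ] B ⊗[ℂ] A
  i_injective : Function.Injective i
  /-- `(F ⊗ id) F = (id ⊗ φ) F` -/
  coassoc : ∀ b, TensorProduct.assoc ℂ B A A (F.toAlgHom.toLinearMap.rTensor A (F b)) =
    (Coalgebra.comul (R := ℂ) (A := A)).lTensor B (F b)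
  /-- `(id ⊗ ε) F = id` -/
  counit : ∀ b, TensorProduct.rid ℂ B ((Coalgebra.counit (R := ℂ) (A := A)).lTensor B (F b)) = b
  /-- `i(V)` is the fixed-point algebra -/
  mem_range_i : ∀ b, b ∈ Set.range i ↔ F b = b ⊗ₜ 1
  /-- the action is free: `q ⊗ b ↦ q F(b)` maps `B ⊗ B` onto `B ⊗ A` -/
  free : Function.Surjective (TensorProduct.lift ((LinearMap.mul ℂ (B ⊗[ℂ] A)).compl₁₂
    (Algebra.TensorProduct.includeLeft (R := ℂ) (S := ℂ) (A := B) (B := A)).toLinearMap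
    F.toAlgHom.toLinearMap))

namespace QuantumPrincipalBundle

variable {A : Type uA} {V : Type uV} {B : Type uB}
    [Ring A] [StarRing A] [HopfAlgebra ℂ A] [StarModule ℂ A]
    [Ring V] [Algebra ℂ V] [StarRing V] [StarModule ℂ V]
    [Ring B] [Algebra ℂ B] [StarRing B] [StarModule ℂ B]
    (P : QuantumPrincipalBundle A V B)

/-- `Mor(u, F)`: the linear maps `φ : H_u → B` with `F φ = (φ ⊗ id) u`. -/
def intertwiners (u : UnitaryRep.{uA, w} A) : Submodule ℂ (u.H →ₗ[ℂ] B) where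
  carrier := {φ | ∀ x, P.F (φ x) = φ.rTensor A (u.coact x)}
  add_mem' {f g} hf hg x := by
    simp only [Set.mem_ofPred_eq] at *
    simp [LinearMap.rTensor_add, hf, hg]
  zero_mem' x := by simp
  smul_mem' c f hf x := by
    simp only [Set.mem_ofPred_eq] at *
    simp [LinearMap.rTensor_smul, hf]

theorem F_i (a : V) : P.F (P.i a) = P.i a ⊗ₜ 1 := (P.mem_range_i _).1 ⟨a, rfl⟩

/-- `(a φ)(x) = i(a) φ(x)`. -/
abbrev leftModule (u : UnitaryRep.{uA, w} A) : Module V (P.intertwiners u) where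
  smul a φ := ⟨LinearMap.mulLeft ℂ (P.i a) ∘ₗ φ.1, fun x => by
    rw [rTensor_mulLeft, ← φ.2 x, ← F_i, ← map_mul]; rfl⟩
  one_smul φ := Subtype.ext <| LinearMap.ext fun x => by
    change P.i 1 * φ.1 x = φ.1 x; simp
  mul_smul a b φ := Subtype.ext <| LinearMap.ext fun x => by
    change P.i (a * b) * φ.1 x = P.i a * (P.i b * φ.1 x); simp [mul_assoc]
  smul_zero a := Subtype.ext <| LinearMap.ext fun x => by
    change P.i a * 0 = 0; simp
  smul_add a φ ψ := Subtype.ext <| LinearMap.ext fun x => by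
    change P.i a * (φ.1 x + ψ.1 x) = P.i a * φ.1 x + P.i a * ψ.1 x; simp [mul_add]
  add_smul a b φ := Subtype.ext <| LinearMap.ext fun x => by
    change P.i (a + b) * φ.1 x = P.i a * φ.1 x + P.i b * φ.1 x; simp [add_mul]
  zero_smul φ := Subtype.ext <| LinearMap.ext fun x => by
    change P.i 0 * φ.1 x = 0; simp

/-- `(φ a)(x) = φ(x) i(a)`. -/
abbrev rightModule (u : UnitaryRep.{uA, w} A) : Module Vᵐᵒᵖ (P.intertwiners u) where
  smul a φ := ⟨LinearMap.mulRight ℂ (P.i a.unop) ∘ₗ φ.1, fun x => by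
    rw [rTensor_mulRight, ← φ.2 x, ← F_i, ← map_mul]; rfl⟩
  one_smul φ := Subtype.ext <| LinearMap.ext fun x => by
    change φ.1 x * P.i 1 = φ.1 x; simp
  mul_smul a b φ := Subtype.ext <| LinearMap.ext fun x => by
    change φ.1 x * P.i (b.unop * a.unop) = φ.1 x * P.i b.unop * P.i a.unop; simp [mul_assoc]
  smul_zero a := Subtype.ext <| LinearMap.ext fun x => by
    change 0 * P.i a.unop = 0; simp
  smul_add a φ ψ := Subtype.ext <| LinearMap.ext fun x => by
    change (φ.1 x + ψ.1 x) * P.i a.unop = φ.1 x * P.i a.unop + ψ.1 x * P.i a.unop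
    simp [add_mul]
  add_smul a b φ := Subtype.ext <| LinearMap.ext fun x => by
    change φ.1 x * P.i (a.unop + b.unop) = φ.1 x * P.i a.unop + φ.1 x * P.i b.unop
    simp [mul_add]
  zero_smul φ := Subtype.ext <| LinearMap.ext fun x => by
    change φ.1 x * P.i 0 = 0; simp

/-- The intertwiner bimodule `E_u = Mor(u, F)`. -/
def E (u : UnitaryRep.{uA, w} A) : Bimodule.{uV, max w uB} V where
  carrier := P.intertwiners u
  leftModule := P.leftModule u
  rightModule := P.rightModule u
  leftTower := by
    let _ := P.leftModule u
    refine ⟨fun c a φ => Subtype.ext <| LinearMap.ext fun x => ?_⟩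
    change P.i (c • a) * φ.1 x = c • (P.i a * φ.1 x)
    simp
  rightTower := by
    let _ := P.rightModule u
    refine ⟨fun c a φ => Subtype.ext <| LinearMap.ext fun x => ?_⟩
    change φ.1 x * P.i (c • a.unop) = c • (φ.1 x * P.i a.unop)
    simp
  smulComm := by
    let _ := P.leftModule u
    let _ := P.rightModule u
    refine ⟨fun a b φ => Subtype.ext <| LinearMap.ext fun x => ?_⟩
    change P.i a * (φ.1 x * P.i b.unop) = P.i a * φ.1 x * P.i b.unop
    rw [mul_assoc]

/-- For `f ∈ Mor(u, v)`, the bimodule homomorphism `f* : E_v → E_u`, `f* φ = φ f`. -/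
def lin (u v : UnitaryRep.{uA, w} A) : Mor u v →ₗ[ℂ] Hom (P.E v) (P.E u) where
  toFun f := ⟨
    { toFun := fun φ => (⟨φ.1 ∘ₗ f.1, fun x => by
        rw [LinearMap.comp_apply, φ.2, f.2, LinearMap.rTensor_comp_apply]⟩ : P.intertwiners u)
      map_add' := fun _ _ => rfl
      map_smul' := fun _ _ => rfl }, fun _ _ => rfl, fun _ _ => rfl⟩
  map_add' f g := by
    refine Subtype.ext <| LinearMap.ext fun φ => Subtype.ext <| LinearMap.ext fun x => ?_
    exact map_add φ.1 (f.1 x) (g.1 x)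
  map_smul' c f := by
    refine Subtype.ext <| LinearMap.ext fun φ => Subtype.ext <| LinearMap.ext fun x => ?_
    exact map_smul φ.1 c (f.1 x)

/-- For an antilinear morphism `f` from `u` to `v`, the antilinear antihomomorphism
`f* : E_v → E_u`, `(f* φ)(x) = φ(f x)*`. -/
def anti (u v : UnitaryRep.{uA, w} A) : AMor u v →ₗ⋆[ℂ] AHom (P.E v) (P.E u) where
  toFun f := ⟨
    { toFun := fun φ => (⟨(starLinearEquiv ℂ (A := B)).toLinearMap.comp (φ.1.comp f.1),
        fun x => by
          have hf := f.2 x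
          have hφ := φ.2 (f.1 x)
          rw [hf] at hφ
          change P.F (star (φ.1 (f.1 x))) = _
          rw [map_star, hφ]
          generalize u.coact x = z
          induction z with
          | zero => simp
          | add p q hp hq => simp only [map_add, star_add, hp, hq]
          | tmul y a => simp⟩ : P.intertwiners u)
      map_add' := fun φ ψ => Subtype.ext <| LinearMap.ext fun x =>
        star_add (φ.1 (f.1 x)) (ψ.1 (f.1 x))
      map_smul' := fun c φ => Subtype.ext <| LinearMap.ext fun x =>
        star_smul c (φ.1 (f.1 x)) },
    fun a φ => Subtype.ext <| LinearMap.ext fun x => by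
      change star (P.i a * φ.1 (f.1 x)) = star (φ.1 (f.1 x)) * P.i (star a)
      rw [star_mul, map_star],
    fun a φ => Subtype.ext <| LinearMap.ext fun x => by
      change star (φ.1 (f.1 x) * P.i a) = P.i (star a) * star (φ.1 (f.1 x))
      rw [star_mul, map_star]⟩
  map_add' f g := by
    refine Subtype.ext <| LinearMap.ext fun φ => Subtype.ext <| LinearMap.ext fun x => ?_
    change star (φ.1 (f.1 x + g.1 x)) = star (φ.1 (f.1 x)) + star (φ.1 (g.1 x))
    rw [map_add, star_add]
  map_smul' c f := by
    refine Subtype.ext <| LinearMap.ext fun φ => Subtype.ext <| LinearMap.ext fun x => ?_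
    change star (φ.1 (c • f.1 x)) = star c • star (φ.1 (f.1 x))
    rw [map_smul, star_smul]

/-- The product `φ ψ ∈ E_{u × v}` of `φ ∈ E_u`, `ψ ∈ E_v`: `x ⊗ y ↦ φ(x) ψ(y)`. -/
def mulElt {u v : UnitaryRep.{uA, w} A} (φ : P.intertwiners u) (ψ : P.intertwiners v) :
    P.intertwiners (u.tensor v) :=
  ⟨LinearMap.mul' ℂ B ∘ₗ TensorProduct.map φ.1 ψ.1, by
    have h : ∀ z : (u.H ⊗[ℂ] A) ⊗[ℂ] (v.H ⊗[ℂ] A),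
        LinearMap.mul' ℂ (B ⊗[ℂ] A) (TensorProduct.map (φ.1.rTensor A) (ψ.1.rTensor A) z) =
        (LinearMap.mul' ℂ B ∘ₗ TensorProduct.map φ.1 ψ.1).rTensor A (tensorMul u.H v.H A z) :=
      tensor4_ext (σ := RingHom.id ℂ)
        (f := LinearMap.mul' ℂ (B ⊗[ℂ] A) ∘ₗ
          TensorProduct.map (φ.1.rTensor A) (ψ.1.rTensor A))
        (g := (LinearMap.mul' ℂ B ∘ₗ TensorProduct.map φ.1 ψ.1).rTensor A ∘ₗ
          tensorMul u.H v.H A)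
        (by intro x a y b; simp)
    have h' : P.F.toAlgHom.toLinearMap ∘ₗ (LinearMap.mul' ℂ B ∘ₗ TensorProduct.map φ.1 ψ.1) =
        (LinearMap.mul' ℂ B ∘ₗ TensorProduct.map φ.1 ψ.1).rTensor A ∘ₗ
          tensorCoact u.coact v.coact := by
      refine TensorProduct.ext' fun x y => ?_
      rw [LinearMap.comp_apply (LinearMap.rTensor _ _), tensorCoact_tmul, ← h,
        TensorProduct.map_tmul, ← φ.2 x, ← ψ.2 y]
      exact map_mul P.F (φ.1 x) (ψ.1 y)
    exact fun z => LinearMap.congr_fun h' z⟩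

/-- The product `(φ, ψ) ↦ φ ψ` as a bilinear map. -/
def mulBil (u v : UnitaryRep.{uA, w} A) :
    (P.E u).carrier →ₗ[ℂ] (P.E v).carrier →ₗ[ℂ] (P.E (u.tensor v)).carrier :=
  LinearMap.mk₂ ℂ (fun φ ψ => P.mulElt φ ψ)
    (fun φ φ' ψ => Subtype.ext <| TensorProduct.ext' fun x y => add_mul (φ.1 x) (φ'.1 x) (ψ.1 y))
    (fun c φ ψ => Subtype.ext <| TensorProduct.ext' fun x y => smul_mul_assoc c (φ.1 x) (ψ.1 y))
    (fun φ ψ ψ' => Subtype.ext <| TensorProduct.ext' fun x y => mul_add (φ.1 x) (ψ.1 y) (ψ'.1 y))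
    (fun c φ ψ => Subtype.ext <| TensorProduct.ext' fun x y => mul_smul_comm c (φ.1 x) (ψ.1 y))

/-- The bimodule homomorphism `E_u ⊗_M E_v → E_{u × v}` induced by the product of `B`. -/
def mulHom (u v : UnitaryRep.{uA, w} A) : Hom ((P.E u).tensor (P.E v)) (P.E (u.tensor v)) :=
  homLift (P.mulBil u v)
    (fun φ a ψ => Subtype.ext <| TensorProduct.ext' fun x y =>
      mul_assoc (φ.1 x) (P.i a) (ψ.1 y))
    (fun a φ ψ => Subtype.ext <| TensorProduct.ext' fun x y =>
      mul_assoc (P.i a) (φ.1 x) (ψ.1 y))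
    (fun a φ ψ => Subtype.ext <| TensorProduct.ext' fun x y =>
      (mul_assoc (φ.1 x) (ψ.1 y) (P.i a)).symm)

theorem mulHom_tmul (u v : UnitaryRep.{uA, w} A) (φ : (P.E u).carrier) (ψ : (P.E v).carrier)
    (x : u.H) (y : v.H) :
    ((P.mulHom u v).1 (Bimodule.tmul φ ψ)).1 (x ⊗ₜ y) = φ.1 x * ψ.1 y := rfl

end QuantumPrincipalBundle

end Bundle

end

end QPB

namespace QPB

noncomputable section

/-! ### Corepresentation matrices -/

section Corep

open Coalgebra HopfAlgebra

variable {A : Type uA} [Ring A] [HopfAlgebra ℂ A]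

/-! Only two assertions are not formal: finite projectivity of $\mathcal E_u$, and bijectivity of
the product map $\mathcal E_u\otimes_M\mathcal E_v\to\mathcal E_{u\times v}$. Both follow from a
frame. If $u$ also denotes the matrix of the representation, an intertwiner is a tuple
$\varphi_j\in\mathcal B$ with $F(\varphi_j)=\sum_i\varphi_i\otimes u_{ij}$. A frame
(`exists_left_frame`) consists of finitely many such tuples $\varphi_k$ and of tuples $q_k$,
transforming under the contragredient matrix, with $\sum_k q_{ki}\varphi_{kj}=\delta_{ij}$.

Given a frame, $l_k(\chi)=\sum_j\chi_j q_{kj}$ is fixed by $F$, hence lies in $i(\mathcal V)$, and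
$\chi=\sum_k l_k(\chi)\varphi_k$: this is a dual basis of the left module. Conjugating a frame for
the matrix $(u_{ij}^*)$ gives one for the right module (`exists_right_frame`). The same contraction
applied to the second leg of $\chi\in\mathcal E_{u\times v}$ gives elements $R_k\chi\in\mathcal
E_u$, and $\chi\mapsto\sum_k R_k\chi\otimes\psi_k$, for a frame $\psi_k$ of $\mathcal E_v$, inverts
the product map (`mulHom_bijective`).

Frames come from freeness and averaging. Freeness writes $1\otimes a$ as
$\sum_k(q_k\otimes1)F(b_k)$. A Haar functional $h$ turns arbitrary elements of $\mathcal B$ into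
covariant tuples through $(\mathrm{id}\otimes h(\,\cdot\,S(u_{ij})))F$, or into contravariant ones
through $(\mathrm{id}\otimes h(u_{ji}\,\cdot\,))F$. Averaging the $b_k$ and then the $q_k$ yields
the frame.

Only $h(1)=1$ and $(\mathrm{id}\otimes h)\phi(a)=h(a)1$ are needed, not positivity, so $h$ is built
algebraically: by an orthogonal projection on the coefficients of one unitary corepresentation
(`exists_invariant`), then by linear algebra on $\mathcal A$ (`exists_haar`). -/

/-- `w` is the matrix of a finite-dimensional corepresentation. -/
structure IsCorepMatrix {ι : Type*} [Fintype ι] [DecidableEq ι] (w : Matrix ι ι A) : Prop where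
  comul : ∀ i j, comul (R := ℂ) (w i j) = ∑ k, w i k ⊗ₜ[ℂ] w k j
  counit : ∀ i j, counit (R := ℂ) (w i j) = (1 : Matrix ι ι ℂ) i j

/-- The antipode applied to the entries of a matrix. -/
def antipodeMatrix {ι : Type*} (w : Matrix ι ι A) : Matrix ι ι A := w.map (antipode ℂ)

namespace IsCorepMatrix

variable {ι : Type*} [Fintype ι] [DecidableEq ι] {w : Matrix ι ι A}

theorem mul_antipodeMatrix (hw : IsCorepMatrix w) : w * antipodeMatrix w = 1 := by
  ext i j
  have h := mul_antipode_lTensor_comul_apply (R := ℂ) (w i j)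
  rw [hw.comul, hw.counit] at h
  simp only [map_sum, LinearMap.lTensor_tmul, LinearMap.mul'_apply] at h
  rw [Matrix.mul_apply]
  refine h.trans ?_
  by_cases hij : i = j <;> simp [Matrix.one_apply, hij]

theorem antipodeMatrix_mul (hw : IsCorepMatrix w) : antipodeMatrix w * w = 1 := by
  ext i j
  have h := mul_antipode_rTensor_comul_apply (R := ℂ) (w i j)
  rw [hw.comul, hw.counit] at h
  simp only [map_sum, LinearMap.rTensor_tmul, LinearMap.mul'_apply] at h
  rw [Matrix.mul_apply]
  refine h.trans ?_
  by_cases hij : i = j <;> simp [Matrix.one_apply, hij]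

/-- In matrices over $\mathcal A\otimes\mathcal A$ one has $\phi(w)=(w\otimes1)(1\otimes w)$. Both
sides of the identity are inverse to $\phi(w)$, so they agree by uniqueness of inverses. -/
theorem comul_antipodeMatrix (hw : IsCorepMatrix w) (i j : ι) :
    Coalgebra.comul (R := ℂ) (antipodeMatrix w i j) =
      ∑ k, antipodeMatrix w k j ⊗ₜ[ℂ] antipodeMatrix w i k := by
  let D : A →+* A ⊗[ℂ] A := (Bialgebra.comulAlgHom ℂ A : A →+* A ⊗[ℂ] A)
  let l : A →+* A ⊗[ℂ] A :=
    (Algebra.TensorProduct.includeLeft (R := ℂ) (S := ℂ) (A := A) (B := A) : A →+* A ⊗[ℂ] A)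
  let r : A →+* A ⊗[ℂ] A :=
    (Algebra.TensorProduct.includeRight (R := ℂ) (A := A) (B := A) : A →+* A ⊗[ℂ] A)
  have map_inv : ∀ (g : A →+* A ⊗[ℂ] A),
      w.map g * (antipodeMatrix w).map g = 1 ∧ (antipodeMatrix w).map g * w.map g = 1 := by
    intro g
    rw [← Matrix.map_mul, ← Matrix.map_mul, hw.mul_antipodeMatrix, hw.antipodeMatrix_mul,
      Matrix.map_one _ (map_zero g) (map_one g)]
    exact ⟨rfl, rfl⟩
  have hD : w.map D = w.map l * w.map r := by
    ext i j
    refine (hw.comul i j).trans ?_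
    simp [Matrix.mul_apply, l, r]
  have key : (antipodeMatrix w).map D = (antipodeMatrix w).map r * (antipodeMatrix w).map l := by
    have h1 : (antipodeMatrix w).map D * w.map D = 1 := (map_inv D).2
    have h2 : w.map D * ((antipodeMatrix w).map r * (antipodeMatrix w).map l) = 1 := by
      rw [hD, mul_assoc, ← mul_assoc (w.map r), (map_inv r).1, one_mul, (map_inv l).1]
    exact left_inv_eq_right_inv h1 h2
  have := congrFun (congrFun key i) j
  refine this.trans ?_
  simp [Matrix.mul_apply, l, r]

end IsCorepMatrix

end Corep

/-! ### The Haar functional -/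

section Haar

open Coalgebra HopfAlgebra

/-! ### Convolution of functionals and matrix coefficients. -/

section Convolution

variable {A : Type uA} [Ring A] [HopfAlgebra ℂ A]

/-- The convolution `a ↦ ∑ f(a₁) g(a₂)` of functionals. -/
def conv (f g : A →ₗ[ℂ] ℂ) : A →ₗ[ℂ] ℂ :=
  LinearMap.mul' ℂ ℂ ∘ₗ TensorProduct.map f g ∘ₗ comul

theorem conv_one (f g : A →ₗ[ℂ] ℂ) : conv f g 1 = f 1 * g 1 := by
  simp [conv, Algebra.TensorProduct.one_def]

theorem conv_sub_smul (f f' g : A →ₗ[ℂ] ℂ) (c : ℂ) :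
    conv (f - c • f') g = conv f g - c • conv f' g := by
  ext a
  simp only [conv, ← TensorProduct.mapBilinear_apply, map_sub, map_smul, LinearMap.sub_apply,
    LinearMap.smul_apply, LinearMap.comp_apply]

theorem conv_counit (g : A →ₗ[ℂ] ℂ) : conv counit g = g := by
  ext a
  have h : ∀ z : ℂ ⊗[ℂ] A, LinearMap.mul' ℂ ℂ (g.lTensor ℂ z) = g (TensorProduct.lid ℂ A z) := by
    intro z
    induction z with
    | zero => simp
    | add x y hx hy => simp only [map_add, hx, hy]
    | tmul c a => simp
  change LinearMap.mul' ℂ ℂ (TensorProduct.map counit g (comul a)) = g a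
  rw [← LinearMap.lTensor_comp_rTensor, LinearMap.comp_apply, h, rTensor_counit_comul]
  simp

/-- On the coefficients of $w$ convolution is the matrix product $f(w)g(w)$; this reduces invariance
to Hilbert space geometry of finite matrices. -/
theorem IsCorepMatrix.conv_apply {ι : Type*} [Fintype ι] [DecidableEq ι] {w : Matrix ι ι A}
    (hw : IsCorepMatrix w) (f g : A →ₗ[ℂ] ℂ) (i j : ι) :
    conv f g (w i j) = ∑ k, f (w i k) * g (w k j) := by
  simp [conv, hw.comul]

/-- The linear span of the entries of a matrix. -/
def coeffSpan {ι : Type*} (w : Matrix ι ι A) : Submodule ℂ A :=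
  Submodule.span ℂ (Set.range fun p : ι × ι => w p.1 p.2)

theorem entry_mem_coeffSpan {ι : Type*} (w : Matrix ι ι A) (i j : ι) : w i j ∈ coeffSpan w :=
  Submodule.subset_span ⟨(i, j), rfl⟩

variable {ι κ : Type*}

theorem coeffSpan_le_fromBlocks_left (w : Matrix ι ι A) (w' : Matrix κ κ A) :
    coeffSpan w ≤ coeffSpan (Matrix.fromBlocks w 0 0 w') := by
  refine Submodule.span_mono ?_
  rintro _ ⟨⟨i, j⟩, rfl⟩
  exact ⟨(Sum.inl i, Sum.inl j), rfl⟩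

theorem coeffSpan_le_fromBlocks_right (w : Matrix ι ι A) (w' : Matrix κ κ A) :
    coeffSpan w' ≤ coeffSpan (Matrix.fromBlocks w 0 0 w') := by
  refine Submodule.span_mono ?_
  rintro _ ⟨⟨i, j⟩, rfl⟩
  exact ⟨(Sum.inr i, Sum.inr j), rfl⟩

theorem mul_mem_coeffSpan {w : Matrix ι ι A} {w' : Matrix κ κ A} {a b : A}
    (ha : a ∈ coeffSpan w) (hb : b ∈ coeffSpan w') :
    a * b ∈ coeffSpan (Matrix.of fun i j : ι × κ => w i.1 j.1 * w' i.2 j.2) := by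
  have h : coeffSpan w * coeffSpan w' ≤
      coeffSpan (Matrix.of fun i j : ι × κ => w i.1 j.1 * w' i.2 j.2) := by
    rw [coeffSpan, coeffSpan, Submodule.span_mul_span, coeffSpan]
    refine Submodule.span_mono ?_
    rintro _ ⟨_, ⟨⟨i, j⟩, rfl⟩, _, ⟨⟨k, l⟩, rfl⟩, rfl⟩
    exact ⟨((i, k), (j, l)), rfl⟩
  exact h (Submodule.mul_mem_mul ha hb)

/-- The values of a functional on the entries of a matrix. -/
def coeffValues {ι : Type*} [Fintype ι] (w : Matrix ι ι A) :
    (A →ₗ[ℂ] ℂ) →ₗ[ℂ] EuclideanSpace ℂ (ι × ι) where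
  toFun f := WithLp.toLp 2 fun p => f (w p.1 p.2)
  map_add' _ _ := rfl
  map_smul' _ _ := rfl

theorem coeffValues_apply {ι : Type*} [Fintype ι] (w : Matrix ι ι A) (f : A →ₗ[ℂ] ℂ) (i j : ι) :
    coeffValues w f (i, j) = f (w i j) := rfl

theorem coeffValues_eq_iff {ι : Type*} [Fintype ι] {w : Matrix ι ι A} {f g : A →ₗ[ℂ] ℂ} :
    coeffValues w f = coeffValues w g ↔ ∀ a ∈ coeffSpan w, f a = g a := by
  constructor
  · intro h a ha
    induction ha using Submodule.span_induction with
    | mem x hx =>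
      obtain ⟨p, rfl⟩ := hx
      exact congrArg (fun z : EuclideanSpace ℂ (ι × ι) => z p) h
    | zero => simp
    | add x y _ _ hx hy => simp [hx, hy]
    | smul c x _ hx => simp [hx]
  · intro h
    ext p
    exact h _ (entry_mem_coeffSpan w p.1 p.2)

end Convolution

variable {A : Type uA} [Ring A] [StarRing A] [HopfAlgebra ℂ A]

/-- A unitary corepresentation matrix. -/
structure IsUnitaryCorep {ι : Type*} [Fintype ι] [DecidableEq ι] (w : Matrix ι ι A) : Prop where
  comul : ∀ i j, comul (R := ℂ) (w i j) = ∑ k, w i k ⊗ₜ[ℂ] w k j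
  isUnitary : w ∈ unitary (Matrix ι ι A)

/-! ### Direct sums and tensor products of unitary corepresentations. -/

namespace IsUnitaryCorep

variable {ι κ : Type*} [Fintype ι] [DecidableEq ι] [Fintype κ] [DecidableEq κ]
  {w : Matrix ι ι A} {w' : Matrix κ κ A}

/-- The counit axiom gives $\epsilon(w)w=w$. Unitarity cancels $w$, and one more application of
$\epsilon$ turns the resulting identity in $\mathcal A$ into one between numbers. -/
theorem isCorepMatrix (hw : IsUnitaryCorep w) : IsCorepMatrix w where
  comul := hw.comul
  counit i j := by
    have h : w.map (fun a => algebraMap ℂ A (counit (R := ℂ) a)) * w = 1 * w := by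
      ext i j
      have h := rTensor_counit_comul (R := ℂ) (w i j)
      rw [hw.comul, map_sum] at h
      simp only [LinearMap.rTensor_tmul] at h
      have h' := congrArg (TensorProduct.lid ℂ A) h
      simp only [map_sum, TensorProduct.lid_tmul, one_smul] at h'
      rw [one_mul, Matrix.mul_apply]
      simpa [Algebra.smul_def] using h'
    have h2 := congrArg (· * star w) h
    simp only [mul_assoc, hw.isUnitary.2, mul_one] at h2
    have h3 := congrArg (counit (R := ℂ)) (congrFun (congrFun h2 i) j)
    by_cases hij : i = j
    · subst hij
      simpa [Bialgebra.counit_algebraMap] using h3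
    · simpa [Bialgebra.counit_algebraMap, hij] using h3

/-- $S(w)$ and $w^*$ are both inverse to $w$. -/
theorem antipode_apply (hw : IsUnitaryCorep w) (i j : ι) :
    antipode ℂ (w i j) = star (w j i) := by
  have h : antipodeMatrix w = star w :=
    left_inv_eq_right_inv hw.isCorepMatrix.antipodeMatrix_mul hw.isUnitary.2
  exact congrFun (congrFun h i) j

theorem one : IsUnitaryCorep (1 : Matrix (Fin 1) (Fin 1) A) where
  comul i j := by
    fin_cases i; fin_cases j
    simp [Algebra.TensorProduct.one_def, Matrix.one_apply]
  isUnitary := Submonoid.one_mem _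

theorem fromBlocks (hw : IsUnitaryCorep w) (hw' : IsUnitaryCorep w') :
    IsUnitaryCorep (Matrix.fromBlocks w 0 0 w') where
  comul i j := by
    rcases i with i | i <;> rcases j with j | j <;> simp [hw.comul, hw'.comul]
  isUnitary := by
    refine ⟨?_, ?_⟩ <;>
    simp only [Matrix.star_eq_conjTranspose, Matrix.fromBlocks_conjTranspose,
      Matrix.fromBlocks_multiply]
    · have h1 : w.conjTranspose * w = 1 := hw.isUnitary.1
      have h2 : w'.conjTranspose * w' = 1 := hw'.isUnitary.1
      simp [h1, h2]
    · have h1 : w * w.conjTranspose = 1 := hw.isUnitary.2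
      have h2 : w' * w'.conjTranspose = 1 := hw'.isUnitary.2
      simp [h1, h2]

theorem kronecker (hw : IsUnitaryCorep w) (hw' : IsUnitaryCorep w') :
    IsUnitaryCorep (Matrix.of fun i j : ι × κ => w i.1 j.1 * w' i.2 j.2) where
  comul i j := by
    simp only [Matrix.of_apply, Bialgebra.comul_mul, hw.comul, hw'.comul,
      Fintype.sum_prod_type, Finset.sum_mul_sum, Algebra.TensorProduct.tmul_mul_tmul]
  isUnitary := by
    obtain ⟨hb1, hb2⟩ := hw.isUnitary
    obtain ⟨hc1, hc2⟩ := hw'.isUnitary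
    refine ⟨?_, ?_⟩
    · ext ⟨i, k⟩ ⟨j, l⟩
      have e1 := congrFun (congrFun hb1 i) j
      have e2 := congrFun (congrFun hc1 k) l
      simp only [Matrix.mul_apply, Matrix.star_apply] at e1 e2
      simp only [Matrix.mul_apply, Matrix.star_apply, Matrix.of_apply, star_mul,
        Fintype.sum_prod_type]
      rw [Finset.sum_comm]
      have : ∀ y x, star (w' y k) * star (w x i) * (w x j * w' y l) =
          star (w' y k) * ((star (w x i) * w x j) * w' y l) := by
        intros; simp only [mul_assoc]
      simp only [this, ← Finset.mul_sum, ← Finset.sum_mul, e1]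
      by_cases h1 : i = j <;> by_cases h2 : k = l <;> simp_all [Matrix.one_apply]
    · ext ⟨i, k⟩ ⟨j, l⟩
      have e1 := congrFun (congrFun hb2 i) j
      have e2 := congrFun (congrFun hc2 k) l
      simp only [Matrix.mul_apply, Matrix.star_apply] at e1 e2
      simp only [Matrix.mul_apply, Matrix.star_apply, Matrix.of_apply, star_mul,
        Fintype.sum_prod_type]
      have : ∀ x y, w i x * w' k y * (star (w' l y) * star (w j x)) =
          w i x * ((w' k y * star (w' l y)) * star (w j x)) := by
        intros; simp only [mul_assoc]
      simp only [this, ← Finset.mul_sum, ← Finset.sum_mul, e2]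
      by_cases h1 : i = j <;> by_cases h2 : k = l <;> simp_all [Matrix.one_apply]

end IsUnitaryCorep

/-! ### Existence of an invariant functional. -/

variable [StarModule ℂ A]

/-- Every element is a linear combination of coefficients of a unitary corepresentation. -/
theorem IsCompactMatrixQuantumGroup.exists_unitaryCorep (hA : IsCompactMatrixQuantumGroup A)
    (a : A) : ∃ (ι : Type) (_ : Fintype ι) (_ : DecidableEq ι) (w : Matrix ι ι A),
      IsUnitaryCorep w ∧ a ∈ coeffSpan w := by
  obtain ⟨n, U, hU, hc, htop⟩ := hA.exists_fundamental
  have ha : a ∈ Algebra.adjoin ℂ (Set.range fun p : Fin n × Fin n => U p.1 p.2) := by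
    rw [htop]; trivial
  induction ha using Algebra.adjoin_induction with
  | mem x hx => exact ⟨_, _, _, U, ⟨hc, hU⟩, Submodule.subset_span hx⟩
  | algebraMap c =>
    refine ⟨_, _, _, 1, IsUnitaryCorep.one, ?_⟩
    rw [Algebra.algebraMap_eq_smul_one]
    exact Submodule.smul_mem _ _ (entry_mem_coeffSpan (1 : Matrix (Fin 1) (Fin 1) A) 0 0)
  | add x y _ _ hx hy =>
    obtain ⟨ι, _, _, w, hw, hxw⟩ := hx
    obtain ⟨κ, _, _, w', hw', hyw⟩ := hy
    exact ⟨_, inferInstance, inferInstance, _, hw.fromBlocks hw',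
      add_mem (coeffSpan_le_fromBlocks_left w w' hxw) (coeffSpan_le_fromBlocks_right w w' hyw)⟩
  | mul x y _ _ hx hy =>
    obtain ⟨ι, _, _, w, hw, hxw⟩ := hx
    obtain ⟨κ, _, _, w', hw', hyw⟩ := hy
    exact ⟨_, inferInstance, inferInstance, _, hw.kronecker hw',
      mul_mem_coeffSpan hxw hyw⟩

/-- The functional `a ↦ conj f(S(a)*)`. -/
def sharp (f : A →ₗ[ℂ] ℂ) : A →ₗ[ℂ] ℂ where
  toFun a := star (f (star (antipode ℂ a)))
  map_add' a b := by simp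
  map_smul' c a := by simp

/-- Thus $f^\sharp(w)$ is the adjoint matrix of $f(w)$: convolving on the left with `sharp f` is
adjoint to convolving on the left with `f`. -/
theorem IsUnitaryCorep.sharp_apply {ι : Type*} [Fintype ι] [DecidableEq ι] {w : Matrix ι ι A}
    (hw : IsUnitaryCorep w) (f : A →ₗ[ℂ] ℂ) (i j : ι) :
    sharp f (w i j) = star (f (w j i)) := by
  simp [sharp, hw.antipode_apply]

/-- An invariant functional on the span of the coefficients of one unitary corepresentation. -/
theorem IsUnitaryCorep.exists_invariant {ι : Type*} [Fintype ι] [DecidableEq ι] {w : Matrix ι ι A}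
    (hw : IsUnitaryCorep w) :
    ∃ h : A →ₗ[ℂ] ℂ, h 1 = 1 ∧ ∀ f : A →ₗ[ℂ] ℂ, ∀ a ∈ coeffSpan w, conv f h a = f 1 * h a := by
  -- `I` is the space of matrices $f(w)$ with $f(1)=0$. Convolution with such an $f$ stays in `I`,
  -- because evaluation at $1$ is multiplicative for convolution.
  let I : Submodule ℂ (EuclideanSpace ℂ (ι × ι)) :=
    (LinearMap.ker (LinearMap.applyₗ (R := ℂ) (M₂ := ℂ) (1 : A))).map (coeffValues w)
  have mem_I : ∀ f : A →ₗ[ℂ] ℂ, f 1 = 0 → coeffValues w f ∈ I := fun f hf =>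
    Submodule.mem_map_of_mem (by simpa using hf)
  let ε : A →ₗ[ℂ] ℂ := counit
  -- The candidate is $h_0=\epsilon-g$, where $g(1)=0$ and $g(w)$ is the projection of $\epsilon(w)$
  -- to `I`: normalised at $1$ and orthogonal to `I`.
  obtain ⟨g, hg0, hg⟩ : I.starProjection (coeffValues w ε) ∈ I := by simp
  have hg0 : g 1 = 0 := by simpa using hg0
  let h₀ := ε - g
  have hh₀ : h₀ 1 = 1 := by simp [h₀, ε, hg0]
  have horth : coeffValues w h₀ ∈ Iᗮ := by
    rw [map_sub, hg]
    exact Submodule.sub_starProjection_mem_orthogonal _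
  -- For $f(1)=0$ the squared norm of $f(w)h_0(w)$ equals $\langle
  -- f^\sharp(w)f(w)h_0(w),h_0(w)\rangle$, which vanishes since the left entry is in `I`.
  have hann : ∀ f : A →ₗ[ℂ] ℂ, f 1 = 0 → coeffValues w (conv f h₀) = 0 := by
    intro f hf
    have hm : coeffValues w (conv (sharp f) (conv f h₀)) ∈ I :=
      mem_I _ (by simp [conv_one, hf])
    rw [← inner_self_eq_zero (𝕜 := ℂ)]
    rw [← (Submodule.mem_orthogonal _ _).1 horth _ hm]
    simp only [PiLp.inner_apply, Fintype.sum_prod_type, coeffValues_apply,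
      hw.isCorepMatrix.conv_apply (sharp f), hw.sharp_apply, RCLike.inner_apply, map_sum, map_mul,
      RCLike.star_def, Finset.mul_sum, RingHomCompTriple.comp_apply, RingHom.id_apply]
    have hX : ∀ i j, conv f h₀ (w i j) * (starRingEnd ℂ) (conv f h₀ (w i j)) =
        ∑ k, h₀ (w k j) * (f (w i k) * (starRingEnd ℂ) (conv f h₀ (w i j))) := by
      intro i j
      nth_rewrite 1 [hw.isCorepMatrix.conv_apply]
      rw [Finset.sum_mul]
      exact Finset.sum_congr rfl fun k _ => by ring
    simp only [hX]
    refine (Finset.sum_congr rfl fun i _ => Finset.sum_comm).trans ?_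
    rw [Finset.sum_comm]
    exact Finset.sum_congr rfl fun i _ => Finset.sum_comm
  refine ⟨h₀, hh₀, fun f a ha => ?_⟩
  -- An arbitrary functional is reduced to one vanishing at $1$ by subtracting $f(1)\epsilon$, where
  -- $\epsilon$ is the unit of convolution.
  have h := coeffValues_eq_iff.1 ((hann (f - f 1 • ε) (by simp [ε])).trans
    (map_zero (coeffValues w)).symm) a ha
  rw [conv_sub_smul, conv_counit] at h
  simpa [sub_eq_zero] using h

/-- The Haar functional. -/
theorem IsCompactMatrixQuantumGroup.exists_haar (hA : IsCompactMatrixQuantumGroup A) :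
    ∃ h : A →ₗ[ℂ] ℂ, h 1 = 1 ∧ ∀ a : A,
      TensorProduct.rid ℂ A (h.lTensor A (comul a)) = h a • (1 : A) := by
  -- A functional is invariant exactly when it kills all `R f a`. A normalisable one exists as soon
  -- as $1$ is not in their span.
  let R (f : A →ₗ[ℂ] ℂ) (a : A) : A := TensorProduct.lid ℂ A (f.rTensor A (comul a)) - f 1 • a
  have hR : ∀ (h f : A →ₗ[ℂ] ℂ) (a : A), h (R f a) = conv f h a - f 1 * h a := by
    intro h f a
    simp only [R, map_sub, map_smul, smul_eq_mul, conv, LinearMap.comp_apply]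
    congr 1
    generalize (comul (R := ℂ) a) = z
    induction z with
    | zero => simp
    | add x y hx hy => simp only [map_add, hx, hy]
    | tmul x y => simp
  let N {ι : Type} (w : Matrix ι ι A) : Submodule ℂ A :=
    Submodule.span ℂ {z | ∃ f, ∃ a ∈ coeffSpan w, z = R f a}
  have N_mono : ∀ {ι κ : Type} {w : Matrix ι ι A} {w' : Matrix κ κ A},
      coeffSpan w ≤ coeffSpan w' → N w ≤ N w' := by
    intro ι κ w w' hww
    refine Submodule.span_mono ?_
    rintro _ ⟨f, a, ha, rfl⟩
    exact ⟨f, a, hww ha, rfl⟩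
  have hN : ∀ z ∈ Submodule.span ℂ {z | ∃ f a, z = R f a},
      ∃ (ι : Type) (_ : Fintype ι) (_ : DecidableEq ι) (w : Matrix ι ι A),
        IsUnitaryCorep w ∧ z ∈ N w := by
    intro z hz
    induction hz using Submodule.span_induction with
    | mem x hx =>
      obtain ⟨f, a, rfl⟩ := hx
      obtain ⟨ι, _, _, w, hw, haw⟩ := hA.exists_unitaryCorep a
      exact ⟨ι, _, _, w, hw, Submodule.subset_span ⟨f, a, haw, rfl⟩⟩
    | zero => exact ⟨_, _, _, 1, IsUnitaryCorep.one, zero_mem _⟩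
    | add x y _ _ hx hy =>
      obtain ⟨ι, _, _, w, hw, hxw⟩ := hx
      obtain ⟨κ, _, _, w', hw', hyw⟩ := hy
      exact ⟨_, inferInstance, inferInstance, _, hw.fromBlocks hw',
        add_mem (N_mono (coeffSpan_le_fromBlocks_left w w') hxw)
          (N_mono (coeffSpan_le_fromBlocks_right w w') hyw)⟩
    | smul c x _ hx =>
      obtain ⟨ι, _, _, w, hw, hxw⟩ := hx
      exact ⟨ι, _, _, w, hw, Submodule.smul_mem _ _ hxw⟩
  -- A relation expressing $1$ involves finitely many $a$, all coefficients of one direct sum $w$.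
  -- The functional invariant on those coefficients would kill $1$, although its value there is $1$.
  have h1 : (1 : A) ∉ Submodule.span ℂ {z | ∃ f a, z = R f a} := by
    intro h1
    obtain ⟨ι, _, _, w, hw, h1w⟩ := hN 1 h1
    obtain ⟨h, hh, hinv⟩ := hw.exists_invariant
    have hle : N w ≤ LinearMap.ker h := by
      refine Submodule.span_le.2 ?_
      rintro _ ⟨f, a, ha, rfl⟩
      simp [hR, hinv f a ha]
    have := hle h1w
    simp [hh] at this
  obtain ⟨h, hh, hle⟩ := Submodule.exists_le_ker_of_notMem h1
  refine ⟨(h 1)⁻¹ • h, by simp [hh], fun a => ?_⟩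
  -- Functionals separate the points of $\mathcal A$, so the identity in $\mathcal A$ can be tested
  -- against each $f$, where it is the vanishing of `h` on `R f a`.
  rw [← sub_eq_zero, ← Module.forall_dual_apply_eq_zero_iff ℂ]
  intro f
  have h0 : h (R f a) = 0 := hle (Submodule.subset_span ⟨f, a, rfl⟩)
  rw [hR] at h0
  have h2 : f (TensorProduct.rid ℂ A (((h 1)⁻¹ • h).lTensor A (comul a))) =
      (h 1)⁻¹ * conv f h a := by
    simp only [conv, LinearMap.comp_apply]
    generalize (comul (R := ℂ) a) = z
    induction z with
    | zero => simp
    | add x y hx hy => simp only [map_add, mul_add, hx, hy]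
    | tmul x y => simp [mul_comm]
  rw [map_sub, h2, sub_eq_zero.1 h0]
  simp; ring

end Haar

/-! ### Slice maps -/

section Slice

variable {A : Type uA} [Ring A] [Algebra ℂ A] {B : Type uB} [Ring B] [Algebra ℂ B]

/-- The slice map `id ⊗ h : B ⊗ A → B`. -/
def slice (B : Type uB) [Ring B] [Algebra ℂ B] (h : A →ₗ[ℂ] ℂ) : B ⊗[ℂ] A →ₗ[ℂ] B :=
  (TensorProduct.rid ℂ B).toLinearMap ∘ₗ h.lTensor B

@[simp] theorem slice_tmul (h : A →ₗ[ℂ] ℂ) (b : B) (a : A) : slice B h (b ⊗ₜ a) = h a • b := by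
  simp [slice]

theorem slice_mul_tmul (h : A →ₗ[ℂ] ℂ) (z : B ⊗[ℂ] A) (c : B) (d : A) :
    slice B h (z * (c ⊗ₜ d)) = slice B (h ∘ₗ LinearMap.mulRight ℂ d) z * c := by
  induction z with
  | zero => simp
  | add x y hx hy => simp only [map_add, add_mul, hx, hy]
  | tmul x y => simp

theorem slice_tmul_mul (h : A →ₗ[ℂ] ℂ) (z : B ⊗[ℂ] A) (c : B) (d : A) :
    slice B h ((c ⊗ₜ d) * z) = c * slice B (h ∘ₗ LinearMap.mulLeft ℂ d) z := by
  induction z with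
  | zero => simp
  | add x y hx hy => simp only [map_add, mul_add, hx, hy]
  | tmul x y => simp

end Slice

/-! ### Translates of the Haar functional by matrix entries. -/

section HaarTranslates

open Coalgebra

variable {A : Type uA} [Ring A] [HopfAlgebra ℂ A] {ι : Type*} [Fintype ι] [DecidableEq ι]
  {u : Matrix ι ι A} {h : A →ₗ[ℂ] ℂ}

/-- Invariance of $h$ at $aS(u_{ik})$ gives `h1`; multiplying on the right by $u_{kj}$ and summing
over $k$ cancels $S(u)$. For fixed $i$, the functionals $h(\,\cdot\,S(u_{ij}))$ therefore produce
tuples covariant under $u$. -/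
theorem slice_mulRight_comul (hu : IsCorepMatrix u)
    (hinv : ∀ a : A, slice A h (comul a) = h a • (1 : A)) (i j : ι) (a : A) :
    slice A (h ∘ₗ LinearMap.mulRight ℂ (antipodeMatrix u i j)) (comul a) =
      ∑ k, h (a * antipodeMatrix u i k) • u k j := by
  have h1 : ∀ k, ∑ m, slice A (h ∘ₗ LinearMap.mulRight ℂ (antipodeMatrix u i m)) (comul a) *
      antipodeMatrix u m k = h (a * antipodeMatrix u i k) • (1 : A) := by
    intro k
    rw [← hinv, Bialgebra.comul_mul, hu.comul_antipodeMatrix, Finset.mul_sum, map_sum]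
    simp only [slice_mul_tmul]
  have h2 : ∀ m, ∑ k, antipodeMatrix u m k * u k j = (1 : Matrix ι ι A) m j := by
    intro m
    rw [← hu.antipodeMatrix_mul, Matrix.mul_apply]
  have h3 : ∀ k, h (a * antipodeMatrix u i k) • u k j =
      (h (a * antipodeMatrix u i k) • (1 : A)) * u k j := by
    intro k; simp
  simp only [h3, ← h1, Finset.sum_mul, mul_assoc]
  rw [Finset.sum_comm]
  simp only [← Finset.mul_sum, h2]
  simp [Matrix.one_apply]

/-- The mirror argument, with invariance at $u_{ki}a$ and cancellation on the left by $S(u_{jk})$.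
These functionals produce tuples covariant under the contragredient matrix $S(u)^{T}$. -/
theorem slice_mulLeft_comul (hu : IsCorepMatrix u)
    (hinv : ∀ a : A, slice A h (comul a) = h a • (1 : A)) (i j : ι) (a : A) :
    slice A (h ∘ₗ LinearMap.mulLeft ℂ (u j i)) (comul a) =
      ∑ k, h (u k i * a) • (antipodeMatrix u).transpose k j := by
  have h1 : ∀ k, ∑ m, u k m * slice A (h ∘ₗ LinearMap.mulLeft ℂ (u m i)) (comul a) =
      h (u k i * a) • (1 : A) := by
    intro k
    rw [← hinv, Bialgebra.comul_mul, hu.comul, Finset.sum_mul, map_sum]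
    simp only [slice_tmul_mul]
  have h2 : ∀ m, ∑ k, antipodeMatrix u j k * u k m = (1 : Matrix ι ι A) j m := by
    intro m
    rw [← hu.antipodeMatrix_mul, Matrix.mul_apply]
  have h3 : ∀ k, h (u k i * a) • (antipodeMatrix u).transpose k j =
      antipodeMatrix u j k * (h (u k i * a) • (1 : A)) := by
    intro k; simp
  simp only [h3, ← h1, Finset.mul_sum, ← mul_assoc]
  rw [Finset.sum_comm]
  simp only [← Finset.sum_mul, h2]
  simp [Matrix.one_apply]

end HaarTranslates

section StarMatrix

variable {A : Type uA} [Ring A] [StarRing A] [HopfAlgebra ℂ A] [StarModule ℂ A]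
  {ι : Type*} [Fintype ι] [DecidableEq ι] {u : Matrix ι ι A}

theorem IsCorepMatrix.map_star (hA : IsCompactMatrixQuantumGroup A)
    (hu : IsCorepMatrix u) (hε : ∀ i j, Coalgebra.counit (R := ℂ) (star (u i j)) = (1 : Matrix ι ι ℂ) i j) :
    IsCorepMatrix (u.map star) where
  comul i j := by
    simp [hA.comul_star, hu.comul]
  counit i j := hε i j

end StarMatrix

/-! ### Frames -/

namespace QuantumPrincipalBundle

open Coalgebra HopfAlgebra

variable {A : Type uA} {V : Type uV} {B : Type uB}
    [Ring A] [StarRing A] [HopfAlgebra ℂ A] [StarModule ℂ A]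
    [Ring V] [Algebra ℂ V] [StarRing V] [StarModule ℂ V]
    [Ring B] [Algebra ℂ B] [StarRing B] [StarModule ℂ B]
    (P : QuantumPrincipalBundle A V B)

section Frames

variable {ι : Type} [Fintype ι]

/-- The tuple `φ` of elements of `B` transforms under the matrix `c`. -/
def IsCovariant (c : Matrix ι ι A) (φ : ι → B) : Prop :=
  ∀ j, P.F (φ j) = ∑ i, φ i ⊗ₜ[ℂ] c i j

theorem isCovariant_star {c : Matrix ι ι A} {φ : ι → B} (hφ : P.IsCovariant c φ) :
    P.IsCovariant (c.map star) fun i => star (φ i) := by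
  intro j
  simp [map_star, hφ j]

/-- Coassociativity of the action moves the outer $F$ to the coproduct, so covariance of averages in
$\mathcal B$ reduces to a property of functionals on $\mathcal A$. -/
theorem F_slice (h : A →ₗ[ℂ] ℂ) (b : B) :
    P.F (slice B h (P.F b)) = (slice A h ∘ₗ comul).lTensor B (P.F b) := by
  have h1 : ∀ (a : A) (z : B ⊗[ℂ] A),
      (slice A h).lTensor B (TensorProduct.assoc ℂ B A A (z ⊗ₜ a)) = h a • z := by
    intro a z
    induction z with
    | zero => simp
    | add x y hx hy => simp only [TensorProduct.add_tmul, map_add, smul_add, hx, hy]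
    | tmul x y => simp
  have h2 : ∀ z : B ⊗[ℂ] A, P.F (slice B h z) = (slice A h).lTensor B
      (TensorProduct.assoc ℂ B A A (P.F.toAlgHom.toLinearMap.rTensor A z)) := by
    intro z
    induction z with
    | zero => simp
    | add x y hx hy => simp only [map_add, hx, hy]
    | tmul x y => simp [h1]
  rw [h2, P.coassoc, LinearMap.lTensor_comp_apply]

theorem isCovariant_slice {c : Matrix ι ι A} {h : ι → A →ₗ[ℂ] ℂ}
    (hc : ∀ j a, slice A (h j) (comul a) = ∑ k, h k a • c k j) (b : B) :
    P.IsCovariant c fun j => slice B (h j) (P.F b) := by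
  intro j
  rw [F_slice]
  generalize P.F b = z
  induction z with
  | zero => simp
  | add x y hx hy => simp only [map_add, hx, hy, TensorProduct.add_tmul, Finset.sum_add_distrib]
  | tmul x y => simp [hc, TensorProduct.tmul_sum, TensorProduct.smul_tmul]

theorem exists_sum_mul_F (a : A) : ∃ (n : ℕ) (q b : Fin n → B),
    ∑ k, (q k ⊗ₜ[ℂ] (1 : A)) * P.F (b k) = 1 ⊗ₜ a := by
  obtain ⟨t, ht⟩ := P.free (1 ⊗ₜ a)
  rw [← ht]
  clear ht
  induction t with
  | zero => exact ⟨0, Fin.elim0, Fin.elim0, by simp⟩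
  | tmul q b => exact ⟨1, fun _ => q, fun _ => b, by simp⟩
  | add s t hs ht =>
    obtain ⟨m, q, b, hs⟩ := hs
    obtain ⟨n, q', b', ht⟩ := ht
    refine ⟨m + n, Fin.append q q', Fin.append b b', ?_⟩
    rw [Fin.sum_univ_add, map_add, ← hs, ← ht]
    simp

variable [DecidableEq ι] {u : Matrix ι ι A} {h : A →ₗ[ℂ] ℂ}

/-- Half of a frame: the $\varphi_k$ are already covariant, while the $q_k$ are arbitrary and serve
a single row $i$. -/
theorem exists_row_frame (hu : IsCorepMatrix u) (h1 : h 1 = 1)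
    (hinv : ∀ a : A, slice A h (comul a) = h a • (1 : A)) (i : ι) :
    ∃ (κ : Type) (_ : Fintype κ) (q : κ → B) (φ : κ → ι → B),
      (∀ k, P.IsCovariant u (φ k)) ∧ ∀ j, ∑ k, q k * φ k j = (1 : Matrix ι ι B) i j := by
  -- Freeness is applied to $1\otimes u_{il}$ for every $l$. Slicing with $h(\,\cdot\,S(u_{lj}))$
  -- gives $h(u_{il}S(u_{lj}))$, and the sum over $l$ is $h(\delta_{ij}1)=\delta_{ij}$.
  choose n q b hqb using fun l => P.exists_sum_mul_F (u i l)
  refine ⟨Σ l, Fin (n l), inferInstance, fun k => q k.1 k.2,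
    fun k j => slice B (h ∘ₗ LinearMap.mulRight ℂ (antipodeMatrix u k.1 j)) (P.F (b k.1 k.2)),
    fun k => P.isCovariant_slice (fun j a => slice_mulRight_comul hu hinv k.1 j a) _,
    fun j => ?_⟩
  have hl : ∀ l, ∑ k, q l k *
      slice B (h ∘ₗ LinearMap.mulRight ℂ (antipodeMatrix u l j)) (P.F (b l k)) =
      h (u i l * antipodeMatrix u l j) • (1 : B) := by
    intro l
    have := congrArg (slice B (h ∘ₗ LinearMap.mulRight ℂ (antipodeMatrix u l j))) (hqb l)
    rw [map_sum, slice_tmul] at this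
    refine Eq.trans ?_ this
    refine Finset.sum_congr rfl fun k _ => ?_
    rw [slice_tmul_mul]
    simp
  rw [Fintype.sum_sigma]
  simp only [hl]
  rw [← Finset.sum_smul, ← map_sum, ← Matrix.mul_apply, hu.mul_antipodeMatrix]
  by_cases hij : i = j <;> simp [Matrix.one_apply, hij, h1]

/-- The coefficients of the row frames are averaged in turn, with $h(u_{ml}\,\cdot\,)$ for row $l$.
They become contravariant, and the sum over $l$ again collapses through $uS(u)=1$. -/
theorem exists_left_frame (hA : IsCompactMatrixQuantumGroup A) (hu : IsCorepMatrix u) :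
    ∃ (κ : Type) (_ : Fintype κ) (q φ : κ → ι → B),
      (∀ k, P.IsCovariant (antipodeMatrix u).transpose (q k)) ∧ (∀ k, P.IsCovariant u (φ k)) ∧
      ∀ i j, ∑ k, q k i * φ k j = (1 : Matrix ι ι B) i j := by
  obtain ⟨h, h1, hinv⟩ := hA.exists_haar
  choose κ _ q φ hφ hqφ using fun l => P.exists_row_frame hu h1 hinv l
  refine ⟨Σ l, κ l, inferInstance,
    fun k m => slice B (h ∘ₗ LinearMap.mulLeft ℂ (u m k.1)) (P.F (q k.1 k.2)),
    fun k => φ k.1 k.2,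
    fun k => P.isCovariant_slice (fun j a => slice_mulLeft_comul hu hinv k.1 j a) _,
    fun k => hφ k.1 k.2, fun m n => ?_⟩
  -- Applying $F$ to the row relation and multiplying by $S(u)$ on the right removes the matrix
  -- created by $F(\varphi)$.
  have hF : ∀ l, ∑ k, P.F (q l k) * (φ l k n ⊗ₜ 1) = 1 ⊗ₜ antipodeMatrix u l n := by
    intro l
    have e1 : ∀ j, (∑ k, P.F (q l k) * ∑ i, φ l k i ⊗ₜ[ℂ] u i j) = (1 : Matrix ι ι _) l j := by
      intro j
      have := congrArg P.F (hqφ l j)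
      simp only [map_sum, map_mul, hφ l _ j] at this
      rw [this]
      by_cases hlj : l = j <;> simp [Matrix.one_apply, hlj]
    have e2 : ∀ k, (φ l k n ⊗ₜ[ℂ] (1 : A)) =
        ∑ j, (∑ i, φ l k i ⊗ₜ[ℂ] u i j) * (1 ⊗ₜ antipodeMatrix u j n) := by
      intro k
      simp only [Finset.sum_mul, Algebra.TensorProduct.tmul_mul_tmul, mul_one]
      rw [Finset.sum_comm]
      simp only [← TensorProduct.tmul_sum, ← Matrix.mul_apply, hu.mul_antipodeMatrix]
      simp [Matrix.one_apply, TensorProduct.tmul_ite]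
    have e3 : ∀ j, ∑ k, P.F (q l k) * ((∑ i, φ l k i ⊗ₜ[ℂ] u i j) * (1 ⊗ₜ antipodeMatrix u j n)) =
        (1 : Matrix ι ι (B ⊗[ℂ] A)) l j * (1 ⊗ₜ antipodeMatrix u j n) := by
      intro j
      rw [← e1, Finset.sum_mul]
      simp only [mul_assoc]
    simp only [e2, Finset.mul_sum]
    rw [Finset.sum_comm]
    simp only [e3]
    simp [Matrix.one_apply]
  have hl : ∀ l, ∑ k, slice B (h ∘ₗ LinearMap.mulLeft ℂ (u m l)) (P.F (q l k)) * φ l k n =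
      h (u m l * antipodeMatrix u l n) • (1 : B) := by
    intro l
    have := congrArg (slice B (h ∘ₗ LinearMap.mulLeft ℂ (u m l))) (hF l)
    rw [map_sum, slice_tmul] at this
    refine Eq.trans ?_ this
    refine Finset.sum_congr rfl fun k _ => ?_
    rw [slice_mul_tmul]
    simp
  rw [Fintype.sum_sigma]
  simp only [hl]
  rw [← Finset.sum_smul, ← map_sum, ← Matrix.mul_apply, hu.mul_antipodeMatrix]
  by_cases hij : m = n <;> simp [Matrix.one_apply, hij, h1]

/-- Contraction of a covariant with a contravariant tuple. -/
theorem sum_mul_F_of_contravariant (hu : IsCorepMatrix u) {q : ι → B}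
    (hq : P.IsCovariant (antipodeMatrix u).transpose q) (X : ι → B ⊗[ℂ] A) :
    ∑ i, (∑ m, X m * (1 ⊗ₜ u m i)) * P.F (q i) = ∑ m, X m * (q m ⊗ₜ 1) := by
  have h : ∀ m, (q m ⊗ₜ[ℂ] (1 : A)) = ∑ i, (1 ⊗ₜ u m i) * P.F (q i) := by
    intro m
    simp only [hq _, Finset.mul_sum, Algebra.TensorProduct.tmul_mul_tmul, one_mul,
      Matrix.transpose_apply]
    rw [Finset.sum_comm]
    simp only [← TensorProduct.tmul_sum, ← Matrix.mul_apply, hu.mul_antipodeMatrix]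
    simp [Matrix.one_apply, TensorProduct.tmul_ite]
  simp only [h, Finset.mul_sum, Finset.sum_mul, mul_assoc]
  exact Finset.sum_comm

/-- The matrices $u$ and $S(u)$ cancel in $\sum_i F(\chi_i)F(q_i)$, so the sum is a fixed element.
-/
theorem sum_mul_mem_range_i (hu : IsCorepMatrix u) {q χ : ι → B}
    (hq : P.IsCovariant (antipodeMatrix u).transpose q) (hχ : P.IsCovariant u χ) :
    ∑ i, χ i * q i ∈ Set.range P.i := by
  rw [P.mem_range_i, TensorProduct.sum_tmul, map_sum]
  have h := P.sum_mul_F_of_contravariant hu hq fun m => χ m ⊗ₜ 1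
  simp only [Algebra.TensorProduct.tmul_mul_tmul, mul_one, one_mul, ← hχ _] at h
  simpa only [map_mul] using h

/-- The right module needs the products $q_i\chi_i$ in the opposite order, which contravariance
under $S(u)^T$ does not control. A left frame for the conjugate matrix has the right order after
applying $*$. -/
theorem exists_right_frame (hA : IsCompactMatrixQuantumGroup A) (hu : IsCorepMatrix u)
    (hε : ∀ i j, Coalgebra.counit (R := ℂ) (star (u i j)) = (1 : Matrix ι ι ℂ) i j) :
    ∃ (κ : Type) (_ : Fintype κ) (φ q : κ → ι → B), (∀ k, P.IsCovariant u (φ k)) ∧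
      (∀ k χ, P.IsCovariant u χ → ∑ i, q k i * χ i ∈ Set.range P.i) ∧
      ∀ i j, ∑ k, φ k j * q k i = (1 : Matrix ι ι B) i j := by
  have hu' := hu.map_star hA hε
  obtain ⟨κ, _, q, φ, hq, hφ, h⟩ := P.exists_left_frame hA hu'
  refine ⟨κ, inferInstance, fun k i => star (φ k i), fun k i => star (q k i), fun k => ?_,
    fun k χ hχ => ?_, fun i j => ?_⟩
  · have := P.isCovariant_star (hφ k)
    rwa [Matrix.map_map, show (star : A → A) ∘ star = id from funext star_star,
      Matrix.map_id] at this
  · obtain ⟨a, ha⟩ := P.sum_mul_mem_range_i hu' (hq k) (P.isCovariant_star hχ)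
    refine ⟨star a, ?_⟩
    rw [map_star, ha]
    simp
  · have := congrArg star (h i j)
    rw [star_sum] at this
    simp only [star_mul] at this
    rw [this]
    by_cases hij : i = j <;> simp [Matrix.one_apply, hij]

end Frames

end QuantumPrincipalBundle

/-! ### Matrices of unitary representations -/

section RepMatrix

variable {A : Type uA} [Ring A] [StarRing A] [HopfAlgebra ℂ A]

/-- The matrix of a unitary representation in an orthonormal basis. -/
def UnitaryRep.matrix (u : UnitaryRep.{uA, w} A) {ι : Type} [Fintype ι]
    (b : OrthonormalBasis ι ℂ u.H) : Matrix ι ι A :=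
  Matrix.of fun i j => coeff u.coact (b i) (b j)

theorem UnitaryRep.coact_basis (u : UnitaryRep.{uA, w} A) {ι : Type} [Fintype ι]
    (b : OrthonormalBasis ι ℂ u.H) (j : ι) :
    u.coact (b j) = ∑ i, b i ⊗ₜ[ℂ] u.matrix b i j := by
  have h : ∀ z : u.H ⊗[ℂ] A,
      z = ∑ i, b i ⊗ₜ[ℂ] TensorProduct.lid ℂ A ((innerₛₗ ℂ (b i)).rTensor A z) := by
    intro z
    induction z with
    | zero => simp
    | add x y hx hy =>
      simp only [map_add, TensorProduct.tmul_add, Finset.sum_add_distrib, ← hx, ← hy]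
    | tmul x a =>
      conv_lhs => rw [← b.sum_repr' x]
      simp [TensorProduct.sum_tmul, TensorProduct.smul_tmul]
  exact h _

theorem UnitaryRep.exists_isUnitaryCorep (u : UnitaryRep.{uA, w} A) :
    ∃ (ι : Type) (_ : Fintype ι) (_ : DecidableEq ι) (b : OrthonormalBasis ι ℂ u.H),
      IsUnitaryCorep (u.matrix b) := by
  obtain ⟨ι, _, _, b, hb⟩ := u.isUnitary
  refine ⟨ι, inferInstance, inferInstance, b, ⟨fun i j => ?_, hb⟩⟩
  have h := LinearMap.congr_fun u.coassoc (b j)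
  simp only [LinearMap.comp_apply, u.coact_basis b, map_sum, LinearMap.rTensor_tmul,
    LinearMap.lTensor_tmul, TensorProduct.sum_tmul, LinearEquiv.coe_coe,
    TensorProduct.assoc_tmul] at h
  have h' := congrArg (fun z => TensorProduct.lid ℂ (A ⊗[ℂ] A)
    ((innerₛₗ ℂ (b i)).rTensor (A ⊗[ℂ] A) z)) h
  simpa [b.inner_eq_ite, ite_smul] using h'.symm

/-- Because $w_{ij}^*=S(w_{ji})$ and $\epsilon S=\epsilon$. This makes the conjugate matrix a
corepresentation matrix. -/
theorem IsUnitaryCorep.counit_star {ι : Type*} [Fintype ι] [DecidableEq ι] {w : Matrix ι ι A}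
    (hw : IsUnitaryCorep w) (i j : ι) :
    Coalgebra.counit (R := ℂ) (star (w i j)) = (1 : Matrix ι ι ℂ) i j := by
  rw [← hw.antipode_apply, HopfAlgebra.counit_antipode, hw.isCorepMatrix.counit]
  simp [Matrix.one_apply, eq_comm]

end RepMatrix

/-- A module with a finite dual basis is finitely generated and projective. -/
theorem finite_projective_of_dualBasis {R M κ : Type*} [Ring R] [AddCommGroup M] [Module R M]
    [Fintype κ] (x : κ → M) (l : κ → M →ₗ[R] R) (h : ∀ m, ∑ k, l k m • x k = m) :
    Module.Finite R M ∧ Module.Projective R M := by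
  let s : M →ₗ[R] κ → R := LinearMap.pi l
  let p : (κ → R) →ₗ[R] M := Fintype.linearCombination R x
  have hp : p ∘ₗ s = LinearMap.id := LinearMap.ext fun m => h m
  refine ⟨Module.Finite.of_surjective p fun m => ⟨s m, LinearMap.congr_fun hp m⟩,
    Module.Projective.of_split s p hp⟩

namespace Bimodule

variable {V : Type uV} [Ring V] [Algebra ℂ V]

theorem exists_hom_inverse {J K : Bimodule.{uV, x} V} (T : Hom J K)
    (hT : Function.Bijective T.1) :
    ∃ S : Hom K J, Function.LeftInverse T.1 S.1 ∧ Function.RightInverse T.1 S.1 := by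
  let e := LinearEquiv.ofBijective T.1 hT
  have he : ∀ k, T.1 (e.symm k) = k := e.apply_symm_apply
  refine ⟨⟨e.symm.toLinearMap, fun a k => hT.1 ?_, fun a k => hT.1 ?_⟩, he, e.symm_apply_apply⟩
  · exact (he _).trans ((congrArg (a • ·) (he k)).symm.trans (T.2.1 a _).symm)
  · exact (he _).trans ((congrArg (MulOpposite.op a • ·) (he k)).symm.trans (T.2.2 a _).symm)

end Bimodule

namespace QuantumPrincipalBundle

open UnitaryRep Bimodule MulOpposite

variable {A : Type uA} {V : Type uV} {B : Type uB}
    [Ring A] [StarRing A] [HopfAlgebra ℂ A] [StarModule ℂ A]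
    [Ring V] [Algebra ℂ V] [StarRing V] [StarModule ℂ V]
    [Ring B] [Algebra ℂ B] [StarRing B] [StarModule ℂ B]
    (P : QuantumPrincipalBundle A V B)

/-! ### Finite projectivity -/

/-! ### Intertwiners as covariant tuples in an orthonormal basis. -/

section Coordinates

variable {u : UnitaryRep.{uA, w} A} {ι : Type} [Fintype ι] (b : OrthonormalBasis ι ℂ u.H)

theorem isCovariant_intertwiner (φ : (P.E u).carrier) :
    P.IsCovariant (u.matrix b) fun j => φ.1 (b j) := by
  intro j
  rw [φ.2 (b j), u.coact_basis b]
  simp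

theorem exists_intertwiner {φ : ι → B} (hφ : P.IsCovariant (u.matrix b) φ) :
    ∃ χ : (P.E u).carrier, ∀ j, χ.1 (b j) = φ j := by
  have hb : ∀ j, b.toBasis.constr ℂ φ (b j) = φ j := fun j => by
    rw [← b.coe_toBasis, Module.Basis.constr_basis]
  have h : P.F.toAlgHom.toLinearMap ∘ₗ b.toBasis.constr ℂ φ =
      (b.toBasis.constr ℂ φ).rTensor A ∘ₗ u.coact := by
    refine b.toBasis.ext fun j => ?_
    simp only [LinearMap.comp_apply, b.coe_toBasis, u.coact_basis b, map_sum,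
      LinearMap.rTensor_tmul, hb]
    exact hφ j
  exact ⟨⟨b.toBasis.constr ℂ φ, fun x => LinearMap.congr_fun h x⟩, hb⟩

theorem intertwiner_ext {φ ψ : (P.E u).carrier} (h : ∀ j, φ.1 (b j) = ψ.1 (b j)) : φ = ψ :=
  Subtype.ext <| b.toBasis.ext fun j => by rw [b.coe_toBasis]; exact h j

theorem left_smul_apply (a : V) (φ : (P.E u).carrier) (x : u.H) :
    (a • φ).1 x = P.i a * φ.1 x := rfl

theorem right_smul_apply (a : V) (φ : (P.E u).carrier) (x : u.H) :
    (op a • φ).1 x = φ.1 x * P.i a := rfl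

theorem add_apply (φ ψ : (P.E u).carrier) (x : u.H) : (φ + ψ).1 x = φ.1 x + ψ.1 x := rfl

theorem sum_apply {κ : Type*} (s : Finset κ) (φ : κ → (P.E u).carrier) (x : u.H) :
    (∑ k ∈ s, φ k).1 x = ∑ k ∈ s, (φ k).1 x :=
  map_sum ((LinearMap.applyₗ x) ∘ₗ (P.intertwiners u).subtype) φ s

/-- Injectivity of $i$ lets the values be pulled back to $\mathcal V$; additivity and linearity are
then checked in $\mathcal B$. -/
theorem exists_left_functional {q : ι → B}
    (hq : ∀ φ : (P.E u).carrier, ∑ j, φ.1 (b j) * q j ∈ Set.range P.i) :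
    ∃ l : (P.E u).carrier →ₗ[V] V, ∀ φ, P.i (l φ) = ∑ j, φ.1 (b j) * q j := by
  choose l hl using hq
  refine ⟨⟨⟨l, fun φ ψ => P.i_injective ?_⟩, fun a φ => P.i_injective ?_⟩, hl⟩
  · simp only [map_add, hl, add_apply, add_mul, Finset.sum_add_distrib]
  · simp only [smul_eq_mul, RingHom.id_apply, map_mul, hl, left_smul_apply, Finset.mul_sum,
      mul_assoc]

theorem exists_right_functional {q : ι → B}
    (hq : ∀ φ : (P.E u).carrier, ∑ j, q j * φ.1 (b j) ∈ Set.range P.i) :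
    ∃ l : (P.E u).carrier →ₗ[Vᵐᵒᵖ] Vᵐᵒᵖ, ∀ φ, P.i (l φ).unop = ∑ j, q j * φ.1 (b j) := by
  choose l hl using hq
  refine ⟨⟨⟨fun φ => op (l φ), fun φ ψ => unop_injective (P.i_injective ?_)⟩,
    fun a φ => unop_injective (P.i_injective ?_)⟩, hl⟩
  · simp only [unop_add, unop_op, map_add, hl, add_apply, mul_add, Finset.sum_add_distrib]
  · obtain ⟨a, rfl⟩ := op_surjective a
    simp only [smul_eq_mul, RingHom.id_apply, unop_mul, unop_op, map_mul, hl, right_smul_apply,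
      Finset.sum_mul, mul_assoc]

end Coordinates

/-- A finite family in `E_u` with a dual family for the left module structure. -/
theorem exists_left_coordinates (hA : IsCompactMatrixQuantumGroup A) (u : UnitaryRep.{uA, w} A) :
    ∃ (ι κ : Type) (_ : Fintype ι) (_ : DecidableEq ι) (_ : Fintype κ)
      (b : OrthonormalBasis ι ℂ u.H) (q : κ → ι → B) (φ : κ → (P.E u).carrier)
      (l : κ → (P.E u).carrier →ₗ[V] V), IsCorepMatrix (u.matrix b) ∧
      (∀ k, P.IsCovariant (antipodeMatrix (u.matrix b)).transpose (q k)) ∧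
      (∀ i j, ∑ k, q k i * (φ k).1 (b j) = (1 : Matrix ι ι B) i j) ∧
      (∀ k χ, P.i (l k χ) = ∑ j, χ.1 (b j) * q k j) ∧ ∀ χ, ∑ k, l k χ • φ k = χ := by
  obtain ⟨ι, _, _, b, hb⟩ := u.exists_isUnitaryCorep
  have hw := hb.isCorepMatrix
  obtain ⟨κ, _, q, φ, hq, hφ, hqφ⟩ := P.exists_left_frame hA hw
  choose φ' hφ' using fun k => P.exists_intertwiner b (hφ k)
  choose l hl using fun k => P.exists_left_functional b
    fun χ => P.sum_mul_mem_range_i hw (hq k) (P.isCovariant_intertwiner b χ)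
  refine ⟨ι, κ, inferInstance, inferInstance, inferInstance, b, q, φ', l, hw, hq,
    fun i j => by simp only [hφ', hqφ], hl, fun χ => P.intertwiner_ext b fun j => ?_⟩
  simp only [sum_apply, left_smul_apply, hl, hφ', Finset.sum_mul, mul_assoc]
  rw [Finset.sum_comm]
  simp only [← Finset.mul_sum, hqφ]
  simp [Matrix.one_apply]

theorem isFiniteProjective_E (hA : IsCompactMatrixQuantumGroup A) (u : UnitaryRep.{uA, w} A) :
    (P.E u).IsFiniteProjective := by
  have hleft : Module.Finite V (P.E u).carrier ∧ Module.Projective V (P.E u).carrier := by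
    obtain ⟨ι, κ, _, _, _, b, q, φ, l, -, -, -, -, h⟩ := P.exists_left_coordinates hA u
    exact finite_projective_of_dualBasis φ l h
  have hright : Module.Finite Vᵐᵒᵖ (P.E u).carrier ∧ Module.Projective Vᵐᵒᵖ (P.E u).carrier := by
    obtain ⟨ι, _, _, b, hb⟩ := u.exists_isUnitaryCorep
    obtain ⟨κ, _, φ, q, hφ, hq, hφq⟩ := P.exists_right_frame hA hb.isCorepMatrix hb.counit_star
    choose φ' hφ' using fun k => P.exists_intertwiner b (hφ k)
    choose l hl using fun k => P.exists_right_functional b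
      fun χ => hq k _ (P.isCovariant_intertwiner b χ)
    refine finite_projective_of_dualBasis φ' l fun χ => P.intertwiner_ext b fun j => ?_
    have hsmul : ∀ k, (l k χ • φ' k).1 (b j) = φ k j * ∑ i, q k i * χ.1 (b i) := by
      intro k
      rw [← hl, ← hφ']
      rfl
    simp only [sum_apply, hsmul, Finset.mul_sum, ← mul_assoc]
    rw [Finset.sum_comm]
    simp only [← Finset.sum_mul, hφq]
    simp [Matrix.one_apply]
  exact ⟨hleft.1, hleft.2, hright.1, hright.2⟩

/-! ### The product identification -/

section Product

variable (u v : UnitaryRep.{uA, w} A)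

/-- Pairing the second leg of $\chi\in\mathcal E_{u\times v}$ with a contravariant tuple of $v$
leaves an intertwiner of $u$. -/
theorem exists_contraction {ι : Type} [Fintype ι] [DecidableEq ι]
    (b : OrthonormalBasis ι ℂ v.H) (hv : IsCorepMatrix (v.matrix b)) {q : ι → B}
    (hq : P.IsCovariant (antipodeMatrix (v.matrix b)).transpose q) :
    ∃ R : (P.E (u.tensor v)).carrier →ₗ[ℂ] (P.E u).carrier,
      ∀ χ x, (R χ).1 x = ∑ j, χ.1 (x ⊗ₜ b j) * q j := by
  let T (χ : u.H ⊗[ℂ] v.H →ₗ[ℂ] B) (j : ι) : u.H →ₗ[ℂ] B :=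
    χ ∘ₗ (TensorProduct.mk ℂ u.H v.H).flip (b j)
  let R₀ : (u.H ⊗[ℂ] v.H →ₗ[ℂ] B) →ₗ[ℂ] u.H →ₗ[ℂ] B :=
    { toFun := fun χ => ∑ j, LinearMap.mulRight ℂ (q j) ∘ₗ T χ j
      map_add' := fun χ χ' => by
        ext x
        simp [T, Finset.sum_add_distrib, add_mul]
      map_smul' := fun c χ => by
        ext x
        simp [T, Finset.smul_sum] }
  have hR₀ : ∀ χ x, R₀ χ x = ∑ j, χ (x ⊗ₜ b j) * q j := fun χ x => by simp [R₀, T]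
  have hT : ∀ (χ : u.H ⊗[ℂ] v.H →ₗ[ℂ] B) (m : ι) (c : A) (z : u.H ⊗[ℂ] A),
      χ.rTensor A (tensorMul u.H v.H A (z ⊗ₜ (b m ⊗ₜ c))) = (T χ m).rTensor A z * (1 ⊗ₜ c) := by
    intro χ m c z
    induction z with
    | zero => simp
    | add x y hx hy => simp only [TensorProduct.add_tmul, map_add, hx, hy, add_mul]
    | tmul x a => simp [T]
  refine ⟨(R₀ ∘ₗ (P.intertwiners (u.tensor v)).subtype).codRestrict (P.intertwiners u) ?_,
    fun χ x => hR₀ χ.1 x⟩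
  intro χ x
  let χ₀ : u.H ⊗[ℂ] v.H →ₗ[ℂ] B := χ.1
  have hF : ∀ j, P.F (χ₀ (x ⊗ₜ b j)) =
      ∑ m, (T χ₀ m).rTensor A (u.coact x) * (1 ⊗ₜ v.matrix b m j) := by
    intro j
    refine (χ.2 (x ⊗ₜ b j)).trans ?_
    change χ₀.rTensor A (tensorMul u.H v.H A (u.coact x ⊗ₜ v.coact (b j))) = _
    simp only [v.coact_basis b, TensorProduct.tmul_sum, map_sum, hT]
  change P.F (R₀ χ₀ x) = (R₀ χ₀).rTensor A (u.coact x)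
  rw [hR₀, map_sum]
  simp only [map_mul, hF]
  -- Here $X_m$ is the value of $\chi(\,\cdot\,\otimes b_m)\otimes\mathrm{id}$ on $u(x)$; the
  -- $v$-matrices cancel and only the coaction of $u$ survives.
  rw [P.sum_mul_F_of_contravariant hv hq]
  simp only [← rTensor_mulRight]
  rw [← LinearMap.sum_apply]
  congr 1
  exact (map_sum (LinearMap.rTensorHom A) _ _).symm

theorem mulHom_bijective (hA : IsCompactMatrixQuantumGroup A) :
    Function.Bijective (P.mulHom u v).1 := by
  obtain ⟨ι, κ, _, _, _, b, q, ψ, l, hv, hq, hqψ, hl, hψ⟩ := P.exists_left_coordinates hA v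
  choose R hR using fun k => P.exists_contraction u v b hv (hq k)
  let t (k : κ) : (P.E u).carrier →ₗ[ℂ] TensorCarrier (P.E u) (P.E v) :=
    (rel (P.E u) (P.E v)).mkQ ∘ₗ (TensorProduct.mk ℂ _ _).flip (ψ k)
  -- The inverse is $\chi\mapsto\sum_k R_k\chi\otimes\psi_k$.
  let S : (P.E (u.tensor v)).carrier →ₗ[ℂ] TensorCarrier (P.E u) (P.E v) := ∑ k, t k ∘ₗ R k
  have hS : ∀ χ, S χ = ∑ k, tmul (R k χ) (ψ k) := fun χ => by
    simp only [S, LinearMap.sum_apply]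
    rfl
  have hleft : ∀ z, S ((P.mulHom u v).1 z) = z := by
    refine tensor_ext (σ := RingHom.id ℂ) (f := S ∘ₗ (P.mulHom u v).1) (g := LinearMap.id)
      fun φ χ => ?_
    -- On a product, $R_k(\varphi\chi)=\varphi\,l_k(\chi)$. The scalar $l_k(\chi)\in\mathcal V$
    -- crosses the tensor sign, and $\sum_k l_k(\chi)\psi_k=\chi$.
    have hRk : ∀ k, R k ((P.mulHom u v).1 (tmul φ χ)) = op (l k χ) • φ := by
      intro k
      refine Subtype.ext (LinearMap.ext fun x => ?_)
      rw [hR, right_smul_apply, hl, Finset.mul_sum]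
      simp only [← mul_assoc]
      rfl
    change S ((P.mulHom u v).1 (tmul φ χ)) = tmul φ χ
    rw [hS]
    simp only [hRk, ← tmul_smul]
    conv_rhs => rw [← hψ χ]
    exact (map_sum ((rel (P.E u) (P.E v)).mkQ ∘ₗ TensorProduct.mk ℂ _ _ φ) _ _).symm
  refine ⟨Function.LeftInverse.injective hleft, fun χ => ⟨S χ, ?_⟩⟩
  have hsum : (P.mulHom u v).1 (S χ) = ∑ k, (P.mulHom u v).1 (tmul (R k χ) (ψ k)) := by
    rw [hS]
    exact map_sum (P.mulHom u v).1 _ _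
  refine hsum.trans ?_
  refine Subtype.ext (TensorProduct.ext (LinearMap.ext fun x => b.toBasis.ext fun j => ?_))
  rw [b.coe_toBasis]
  refine (P.sum_apply (u := u.tensor v) Finset.univ
    (fun k => (P.mulHom u v).1 (tmul (R k χ) (ψ k))) (x ⊗ₜ b j)).trans ?_
  change ∑ k, (R k χ).1 x * (ψ k).1 (b j) = χ.1 (x ⊗ₜ b j)
  simp only [hR, Finset.sum_mul, mul_assoc]
  rw [Finset.sum_comm]
  simp only [← Finset.mul_sum, hqψ]
  simp [Matrix.one_apply]

end Product

/-! ### Naturality and associativity -/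

section Naturality

variable {u p v q : UnitaryRep.{uA, w} A}

theorem lin_mulHom (φ : Mor u v) (ψ : Mor p q) (z : ((P.E v).tensor (P.E q)).carrier) :
    (P.lin _ _ (morTensor φ ψ)).1 ((P.mulHom v q).1 z) =
      (P.mulHom u p).1 ((homTensor (P.lin u v φ) (P.lin p q ψ)).1 z) :=
  tensor_ext (σ := RingHom.id ℂ) (f := (P.lin _ _ (morTensor φ ψ)).1 ∘ₗ (P.mulHom v q).1)
    (g := (P.mulHom u p).1 ∘ₗ (homTensor (P.lin u v φ) (P.lin p q ψ)).1)
    (fun _ _ => Subtype.ext <| TensorProduct.ext' fun _ _ => rfl) z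

/-- On simple tensors this is $(bc)^*=c^*b^*$, which accounts for the reversal of factors in the
twisted products. -/
theorem anti_mulHom (φ : AMor u q) (ψ : AMor p v) (z : ((P.E v).tensor (P.E q)).carrier) :
    (P.anti _ _ (amorTwist φ ψ)).1 ((P.mulHom v q).1 z) =
      (P.mulHom u p).1 ((ahomTwist (P.anti p v ψ) (P.anti u q φ)).1 z) :=
  tensor_ext (σ := starRingEnd ℂ)
    (f := (P.anti _ _ (amorTwist φ ψ)).1.comp (P.mulHom v q).1)
    (g := (P.mulHom u p).1.comp (ahomTwist (P.anti p v ψ) (P.anti u q φ)).1)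
    (fun α β => Subtype.ext <| TensorProduct.ext' fun x y =>
      star_mul (α.1 (ψ.1 y)) (β.1 (φ.1 x))) z

/-- Once evaluated on simple tensors, both sides are triple products in $\mathcal B$. -/
theorem mulHom_assoc (u v t : UnitaryRep.{uA, w} A)
    (z : (((P.E u).tensor (P.E v)).tensor (P.E t)).carrier) :
    (P.mulHom (u.tensor v) t).1 ((homTensor (P.mulHom u v) (homId (P.E t))).1 z) =
      (P.lin _ _ (assocMor u v t)).1 ((P.mulHom u (v.tensor t)).1
        ((homTensor (homId (P.E u)) (P.mulHom v t)).1 ((assocHom (P.E u) (P.E v) (P.E t)).1 z))) := by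
  let f := (P.mulHom (u.tensor v) t).1 ∘ₗ (homTensor (P.mulHom u v) (homId (P.E t))).1
  let g := (P.lin _ _ (assocMor u v t)).1 ∘ₗ (P.mulHom u (v.tensor t)).1 ∘ₗ
    (homTensor (homId (P.E u)) (P.mulHom v t)).1 ∘ₗ (assocHom (P.E u) (P.E v) (P.E t)).1
  refine tensor_ext (J := (P.E u).tensor (P.E v)) (K := P.E t) (σ := RingHom.id ℂ)
    (f := f) (g := g) (fun y γ => ?_) z
  let m : ((P.E u).tensor (P.E v)).carrier →ₗ[ℂ]
      TensorCarrier ((P.E u).tensor (P.E v)) (P.E t) :=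
    (rel _ _).mkQ ∘ₗ (TensorProduct.mk ℂ _ _).flip γ
  refine tensor_ext (J := P.E u) (K := P.E v) (σ := RingHom.id ℂ) (f := f ∘ₗ m) (g := g ∘ₗ m)
    (fun α β => Subtype.ext <| TensorProduct.ext_threefold fun x y s => ?_) y
  exact mul_assoc (α.1 x) (β.1 y) (γ.1 s)

theorem lin_assocMor_injective (u v t : UnitaryRep.{uA, w} A) :
    Function.Injective (P.lin _ _ (assocMor u v t)).1 := by
  intro ξ ξ' h
  refine Subtype.ext (LinearMap.ext fun x => ?_)
  have := LinearMap.congr_fun (congrArg Subtype.val h)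
    ((TensorProduct.assoc ℂ u.H v.H t.H).symm x)
  have e := (TensorProduct.assoc ℂ u.H v.H t.H).apply_symm_apply x
  exact (congrArg ξ.1 e).symm.trans (this.trans (congrArg ξ'.1 e))

end Naturality

end QuantumPrincipalBundle

namespace Bimodule

variable {V : Type uV} [Ring V] [Algebra ℂ V] {J K J' K' : Bimodule.{uV, x} V}

theorem homTensor_leftInverse {S : Hom J J'} {S' : Hom J' J} {T : Hom K K'} {T' : Hom K' K}
    (hS : Function.LeftInverse S'.1 S.1) (hT : Function.LeftInverse T'.1 T.1) :
    Function.LeftInverse (homTensor S' T').1 (homTensor S T).1 :=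
  tensor_ext (σ := RingHom.id ℂ) (f := (homTensor S' T').1 ∘ₗ (homTensor S T).1)
    (g := LinearMap.id) fun j k => congrArg₂ tmul (hS j) (hT k)

end Bimodule

end

end QPB

/-! ### Assembly of the representation. -/

theorem mainTheorem4 {A : Type uA} {V : Type uV} {B : Type uB}
    [Ring A] [StarRing A] [HopfAlgebra ℂ A] [StarModule ℂ A]
    [Ring V] [Algebra ℂ V] [StarRing V] [StarModule ℂ V]
    [Ring B] [Algebra ℂ B] [StarRing B] [StarModule ℂ B]
    (hA : QPB.IsCompactMatrixQuantumGroup A) (P : QPB.QuantumPrincipalBundle A V B) :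
    ∃ ϑ : ∀ u v : QPB.UnitaryRep.{uA, w} A,
        QPB.Bimodule.Hom (P.E (u.tensor v)) ((P.E u).tensor (P.E v)),
      (∀ u v, Function.LeftInverse (P.mulHom u v).1 (ϑ u v).1 ∧
        Function.RightInverse (P.mulHom u v).1 (ϑ u v).1) ∧
      QPB.IsRepresentation P.E P.lin P.anti ϑ := by
  choose ϑ hϑ using fun u v : QPB.UnitaryRep.{uA, w} A =>
    QPB.Bimodule.exists_hom_inverse (P.mulHom u v) (P.mulHom_bijective u v hA)
  have hl : ∀ u v ξ, (P.mulHom u v).1 ((ϑ u v).1 ξ) = ξ := fun u v => (hϑ u v).1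
  have hr : ∀ u v z, (ϑ u v).1 ((P.mulHom u v).1 z) = z := fun u v => (hϑ u v).2
  refine ⟨ϑ, hϑ, ?_⟩
  constructor
  · exact P.isFiniteProjective_E hA
  · intro u
    refine Prod.ext rfl ?_
    exact map_zero (P.anti u u)
  · intro u v t g f
    refine Prod.ext ?_ ?_
    · refine Subtype.ext <| LinearMap.ext fun φ => Subtype.ext <| LinearMap.ext fun x => ?_
      change φ.1 (g.1.1 (f.1.1 x) + g.2.1 (f.2.1 x)) =
        φ.1 (g.1.1 (f.1.1 x)) + star (star (φ.1 (g.2.1 (f.2.1 x))))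
      rw [map_add, star_star]
    · refine Subtype.ext <| LinearMap.ext fun φ => Subtype.ext <| LinearMap.ext fun x => ?_
      change star (φ.1 (g.1.1 (f.2.1 x) + g.2.1 (f.1.1 x))) =
        star (φ.1 (g.2.1 (f.1.1 x))) + star (φ.1 (g.1.1 (f.2.1 x)))
      rw [map_add, star_add, add_comm]
  · exact fun u v => ⟨(hϑ u v).1.injective, (hϑ u v).2.surjective⟩
  · intro u p v q φ ψ ξ
    -- Every element is a product image, so naturality of $\vartheta$ is naturality of the product
    -- map read backwards.
    conv_lhs => rw [← hl v q ξ]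
    rw [P.lin_mulHom, hr]
  · intro u p v q φ ψ ξ
    conv_lhs => rw [← hl v q ξ]
    rw [P.anti_mulHom, hr]
  · intro u v t ξ
    -- Associativity of the product is evaluated at this $\eta$. Its left side collapses to $\xi$
    -- transported along the associator; cancelling the injective associator expresses $\xi$ as an
    -- iterated product, and the two remaining $\vartheta$ undo it.
    set η := (QPB.Bimodule.homTensor (ϑ u v) (QPB.Bimodule.homId (P.E t))).1
      ((ϑ (u.tensor v) t).1 ((P.lin _ _ (QPB.UnitaryRep.assocMor u v t)).1 ξ)) with hη
    have h := P.mulHom_assoc u v t η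
    have h1 : (QPB.Bimodule.homTensor (P.mulHom u v) (QPB.Bimodule.homId (P.E t))).1 η =
        (ϑ (u.tensor v) t).1 ((P.lin _ _ (QPB.UnitaryRep.assocMor u v t)).1 ξ) :=
      QPB.Bimodule.homTensor_leftInverse (S := ϑ u v) (S' := P.mulHom u v)
        (T := QPB.Bimodule.homId (P.E t)) (T' := QPB.Bimodule.homId (P.E t))
        (hϑ u v).1 (fun _ => rfl) _
    rw [h1, hl] at h
    have h2 := P.lin_assocMor_injective u v t h
    rw [h2, hr]
    exact (QPB.Bimodule.homTensor_leftInverse (S := QPB.Bimodule.homId (P.E u))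
      (S' := QPB.Bimodule.homId (P.E u)) (T := P.mulHom v t) (T' := ϑ v t)
      (fun _ => rfl) (hϑ v t).2 _).symm
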